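/- Let $F$ be a totally real number field of degree $d>1$ with ring of integers $\mathcal O$, different $\mathfrak d$ and real embeddings $\sigma_1,\dots,\sigma_d$; write $a_i=\sigma_i(a)$. Let $\mathcal O^{\times+}$ be the group of totally positive units. Let $\mathfrak c$ be a (nonzero) fractional ideal, $\mathfrak n$ a nonzero integral ideal, $\mathfrak c^+$ the set of totally positive elements of $\mathfrak c$, and $$\Gamma=\Gamma_0(\mathfrak c,\mathfrak n)=\left\{\begin{pmatrix}a&b\\c&e\end{pmatrix}: a,e\in\mathcal O,\ b\in(\mathfrak{cd})^{-1},\ c\in\mathfrak{cnd},\ ae-bc\in\mathcal O^{\times+}\right\}.$$ Let $\Gamma_\infty\le\Gamma$ be the group of products $\begin{pmatrix}\varepsilon&0\\0&1\end{pmatrix}\begin{pmatrix}\eta&0\\0&\eta\end{pmatrix}\begin{pmatrix}1&b\\0&1\end{pmatrix}$ with $\varepsilon\in\mathcal O^{\times+}$, $\eta\in\mathcal O^\times$, $b\in(\mathfrak{cd})^{-1}$. For $\phi:\mathbb H^d\to\mathbb C$, $\mathbf k\in\mathbb N_0^d$ and $\gamma=\begin{pmatrix}a&b\\c&e\end{pmatrix}\in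 \mathrm{GL}_2(F)$ of totally positive determinant put $$(\phi|_{\mathbf k}\gamma)(z)=\prod_{i=1}^d \det(\gamma)_i^{k_i/2}(c_iz_i+e_i)^{-k_i}\cdot\phi(\gamma z),$$ where $\gamma$ acts on $\mathbb H^d$ by componentwise Möbius transformations. Let $M_{\mathbf k}(\Gamma)$ be the space of holomorphic $f:\mathbb H^d\to\mathbb C$ with $f|_{\mathbf k}\gamma=f$ for all $\gamma\in\Gamma$; $f\in M_{\mathbf k}(\Gamma)$ is a cusp form if the Fourier expansion of $f|_{\mathbf k}A$ has constant term $0$ for every $A\in\mathrm{SL}_2(F)$. For a function $\phi$ on $\mathbb H^d$ with $\phi|_{\mathbf k}\gamma=\phi$ for all $\gamma\in\Gamma_\infty$, the Hilbert Poincaré series with seed $\phi$ is $$\mathbb P_{\mathbf k}(\phi;z)=\sum_{M\in\Gamma_\infty\backslash\Gamma}(\phi|_{\mathbf k}M)(z).$$ Write $e(\nu z)=\exp\big(2\pi i\sum_i\nu_iz_i\big)$. For $\mu\in\mathfrak c^+$ let $$P_\mu(z;\mathbf k,\mathfrak c,\mathfrak n)=\mathbb P_{\mathbf k}(\phi_{\mathbf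 k,\mu};z),\qquad \phi_{\mathbf k,\mu}(z)=\sum_{\varepsilon\in\mathcal O^{\times+}}\Big(\prod_i\varepsilon_i^{k_i/2}\Big)\,e(\varepsilon\mu z).$$ For $\mathbf n\in\mathbb N_0^d$ and holomorphic $f_1,f_2$ on $\mathbb H^d$ of weights $\mathbf k_1,\mathbf k_2$, the $\mathbf n$-th Rankin–Cohen bracket is $$[f_1,f_2]_{\mathbf n}=\sum_{0\le l_j\le n_j}(-1)^{|\mathfrak l|}\binom{\mathbf k_1+\mathbf n-\mathbf 1}{\mathbf n-\mathfrak l}\binom{\mathbf k_2+\mathbf n-\mathbf 1}{\mathfrak l}f_1^{(\mathfrak l)}f_2^{(\mathbf n-\mathfrak l)},$$ where $|\mathfrak l|=\sum_j l_j$, $f^{(\mathfrak l)}=\partial^{|\mathfrak l|}f/\partial z_1^{l_1}\cdots\partial z_d^{l_d}$, and binomial coefficients of vectors are products of the componentwise ones. **Theorem.** Let $\mathbf n\in\mathbb N_0^d$, $\mathbf k_1,\mathbf k_2\in\mathbb Z_{>2}^d$ and $\mu\in\mathfrak c^+$, and suppose that $\prod_i\operatorname{sgn}(\eta_i)^{k_{2,i}}=1$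 for all $\eta\in\mathcal O^\times$ (equivalently, the seed $\phi_{\mathbf k_2,\mu}$ of $P_\mu$ is invariant under $\Gamma_\infty$). Let $f\in M_{\mathbf k_1}(\Gamma)$; if $f$ is not a cusp form, assume moreover that $\mathbf k_2\ge\mathbf k_1+2$ componentwise. Put $\mathbf K=\mathbf k_1+\mathbf k_2+2\mathbf n$, $$\phi(z)=e(\mu z)\sum_{0\le l_j\le n_j}(-1)^{|\mathfrak l|}\binom{\mathbf k_1+\mathbf n-\mathbf 1}{\mathbf n-\mathfrak l}\binom{\mathbf k_2+\mathbf n-\mathbf 1}{\mathfrak l}\Big(\prod_j(2\pi i\mu_j)^{n_j-l_j}\Big)f^{(\mathfrak l)}(z),$$ $$\widetilde\phi=\sum_{\varepsilon\in\mathcal O^{\times+}}\phi\,\Big|_{\mathbf K}\begin{pmatrix}\varepsilon&0\\0&1\end{pmatrix}.$$ Then the series over $\mathcal O^{\times+}$ defining $\phi_{\mathbf k_2,\mu}$ and $\widetilde\phi$ converge absolutely at every point of $\mathbb H^d$, the functions $\phi_{\mathbf k_2,\mu}$ and $\widetilde\phi$ are invariant under the actions of $\Gamma_\infty$ of weight $\mathbf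 k_2$ and $\mathbf K$ respectively, the Poincaré series $P_\mu(z;\mathbf k_2,\mathfrak c,\mathfrak n)$ and $\mathbb P_{\mathbf K}(\widetilde\phi;z)$ converge absolutely and locally uniformly on $\mathbb H^d$, and $$[f,P_\mu(\,\cdot\,;\mathbf k_2,\mathfrak c,\mathfrak n)]_{\mathbf n}(z)=\mathbb P_{\mathbf K}(\widetilde\phi;z)\qquad\text{for all } z\in\mathbb H^d.$$ -/

import Mathlib

set_option linter.unusedSectionVars false

open scoped NumberField nonZeroDivisors

namespace HilbertPoincare

noncomputable section

section Groups

variable {F : Type*} [Field F]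

/-- `a` is totally positive: its image under every real embedding is positive. -/
def IsTotallyPositive (a : F) : Prop := ∀ τ : F →+* ℝ, 0 < τ a

variable [NumberField F]

/-- The group of totally positive units of the ring of integers. -/
def totPosUnits (F : Type*) [Field F] [NumberField F] : Subgroup (𝓞 F)ˣ where
  carrier := {u | IsTotallyPositive ((u : 𝓞 F) : F)}
  one_mem' := fun τ => by simp
  mul_mem' := fun {a b} ha hb τ => by
    have h := mul_pos (ha τ) (hb τ)
    simpa using h
  inv_mem' := fun {a} ha τ => by
    have h1 : ((a : 𝓞 F) : F) * (((a⁻¹ : (𝓞 F)ˣ) : 𝓞 F) : F) = 1 := by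
      rw [← map_mul, Units.mul_inv, map_one]
    have h2 : τ ((a : 𝓞 F) : F) * τ (((a⁻¹ : (𝓞 F)ˣ) : 𝓞 F) : F) = 1 := by
      rw [← map_mul, h1, map_one]
    exact pos_of_mul_pos_right (h2 ▸ one_pos) (ha τ).le

/-- The different of `F` over `ℚ`, as a fractional ideal. -/
def different (F : Type*) [Field F] [NumberField F] : FractionalIdeal (𝓞 F)⁰ F :=
  ((differentIdeal ℤ (𝓞 F) : Ideal (𝓞 F)) : FractionalIdeal (𝓞 F)⁰ F)

/-- Membership in `Γ₀(𝔠, 𝔫)`: diagonal entries in `𝓞`, upper right entry in `(𝔠𝔡)⁻¹`, lower left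
entry in `𝔠𝔫𝔡`, determinant a totally positive unit. -/
def MemGamma0 (𝔠 : FractionalIdeal (𝓞 F)⁰ F) (𝔫 : Ideal (𝓞 F)) (γ : GL (Fin 2) F) : Prop :=
  γ 0 0 ∈ (1 : FractionalIdeal (𝓞 F)⁰ F) ∧ γ 1 1 ∈ (1 : FractionalIdeal (𝓞 F)⁰ F) ∧
  γ 0 1 ∈ (𝔠 * different F)⁻¹ ∧
  γ 1 0 ∈ 𝔠 * (𝔫 : FractionalIdeal (𝓞 F)⁰ F) * different F ∧
  ∃ u ∈ totPosUnits F, γ.val.det = ((u : 𝓞 F) : F)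

theorem mul_mem_one_aux {𝔠 : FractionalIdeal (𝓞 F)⁰ F} {𝔫 : Ideal (𝓞 F)} {x y : F}
    (hx : x ∈ (𝔠 * different F)⁻¹)
    (hy : y ∈ 𝔠 * (𝔫 : FractionalIdeal (𝓞 F)⁰ F) * different F) :
    x * y ∈ (1 : FractionalIdeal (𝓞 F)⁰ F) := by
  have h := FractionalIdeal.mul_mem_mul hx hy
  have e : (𝔠 * different F)⁻¹ * (𝔠 * (𝔫 : FractionalIdeal (𝓞 F)⁰ F) * different F)
      ≤ 1 := by
    calc _ = ((𝔠 * different F)⁻¹ * (𝔠 * different F)) * (𝔫 : FractionalIdeal (𝓞 F)⁰ F) := by ring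
      _ ≤ 1 * 1 := by
        refine mul_le_mul' ?_ FractionalIdeal.coeIdeal_le_one
        by_cases h0 : 𝔠 * different F = 0
        · rw [h0, mul_zero]; exact zero_le
        · rw [inv_mul_cancel₀ h0]
      _ = 1 := one_mul 1
  exact e h

theorem unit_smul_mem (I : FractionalIdeal (𝓞 F)⁰ F) (u : (𝓞 F)) {x : F} (hx : x ∈ I) :
    (u : F) * x ∈ I := by
  have h := Submodule.smul_mem (I : Submodule (𝓞 F) F) u hx
  rwa [Algebra.smul_def] at h

theorem one_mul_mem (I : FractionalIdeal (𝓞 F)⁰ F) {y x : F}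
    (hy : y ∈ (1 : FractionalIdeal (𝓞 F)⁰ F)) (hx : x ∈ I) : y * x ∈ I := by
  have h := FractionalIdeal.mul_mem_mul hy hx
  rwa [one_mul] at h

/-- The congruence subgroup `Γ₀(𝔠, 𝔫)` of `GL₂(F)`. -/
def Gamma0 (𝔠 : FractionalIdeal (𝓞 F)⁰ F) (𝔫 : Ideal (𝓞 F)) : Subgroup (GL (Fin 2) F) where
  carrier := {γ | MemGamma0 𝔠 𝔫 γ}
  one_mem' := by
    refine ⟨?_, ?_, ?_, ?_, 1, one_mem _, ?_⟩
    · simp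
    · simp
    · simpa using FractionalIdeal.zero_mem _
    · simpa using FractionalIdeal.zero_mem _
    · simp
  mul_mem' := by
    rintro γ δ ⟨ha, hd, hb, hc, u, hu, hdet⟩ ⟨ha', hd', hb', hc', v, hv, hdet'⟩
    refine ⟨?_, ?_, ?_, ?_, u * v, mul_mem hu hv, ?_⟩
    · simp only [Units.val_mul, Matrix.mul_apply, Fin.sum_univ_two]
      exact Submodule.add_mem _ (one_mul_mem _ ha ha') (mul_mem_one_aux hb hc')
    · simp only [Units.val_mul, Matrix.mul_apply, Fin.sum_univ_two]
      refine Submodule.add_mem _ ?_ (one_mul_mem _ hd hd')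
      rw [mul_comm]; exact mul_mem_one_aux hb' hc
    · simp only [Units.val_mul, Matrix.mul_apply, Fin.sum_univ_two]
      refine Submodule.add_mem _ (one_mul_mem _ ha hb') ?_
      rw [mul_comm (γ.val 0 1)]; exact one_mul_mem _ hd' hb
    · simp only [Units.val_mul, Matrix.mul_apply, Fin.sum_univ_two]
      refine Submodule.add_mem _ ?_ (one_mul_mem _ hd hc')
      rw [mul_comm (γ.val 1 0)]; exact one_mul_mem _ ha' hc
    · rw [Units.val_mul, Matrix.det_mul, hdet, hdet', Units.val_mul]
      exact (map_mul (algebraMap (𝓞 F) F) _ _).symm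
  inv_mem' := by
    rintro γ ⟨ha, hd, hb, hc, u, hu, hdet⟩
    have hinv : Ring.inverse γ.val.det = (((u⁻¹ : (𝓞 F)ˣ) : 𝓞 F) : F) := by
      rw [Ring.inverse_eq_inv', hdet]
      refine inv_eq_of_mul_eq_one_right ?_
      rw [← map_mul, Units.mul_inv, map_one]
    have hγ : (γ⁻¹).val = (((u⁻¹ : (𝓞 F)ˣ) : 𝓞 F) : F) •
        !![γ 1 1, -γ 0 1; -γ 1 0, γ 0 0] := by
      rw [Matrix.coe_units_inv, Matrix.inv_def, hinv, Matrix.adjugate_fin_two]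
    refine ⟨?_, ?_, ?_, ?_, u⁻¹, inv_mem hu, ?_⟩
    · rw [hγ]; exact unit_smul_mem _ _ hd
    · rw [hγ]; exact unit_smul_mem _ _ ha
    · rw [hγ]; exact unit_smul_mem _ _ (Submodule.neg_mem _ hb)
    · rw [hγ]; exact unit_smul_mem _ _ (Submodule.neg_mem _ hc)
    · rw [Matrix.coe_units_inv, Matrix.det_nonsing_inv, hinv]

/-- The matrix `diag(ε, 1)`. -/
def matU (ε : (𝓞 F)ˣ) : GL (Fin 2) F :=
  Matrix.GeneralLinearGroup.mkOfDetNeZero !![((ε : 𝓞 F) : F), 0; 0, 1] (by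
    simp [Matrix.det_fin_two])

/-- The matrix `diag(η, η)`. -/
def matZ (η : (𝓞 F)ˣ) : GL (Fin 2) F :=
  Matrix.GeneralLinearGroup.mkOfDetNeZero !![((η : 𝓞 F) : F), 0; 0, ((η : 𝓞 F) : F)] (by
    simp [Matrix.det_fin_two])

/-- The matrix `(1 b; 0 1)`. -/
def matN (b : F) : GL (Fin 2) F :=
  Matrix.GeneralLinearGroup.mkOfDetNeZero !![1, b; 0, 1] (by simp [Matrix.det_fin_two])

theorem matUZN_val (ε η : (𝓞 F)ˣ) (b : F) : (matU ε * matZ η * matN b).val =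
    !![((ε : 𝓞 F) : F) * ((η : 𝓞 F) : F), ((ε : 𝓞 F) : F) * ((η : 𝓞 F) : F) * b;
      0, ((η : 𝓞 F) : F)] := by
  ext i j
  fin_cases i <;> fin_cases j <;>
    simp [matU, matZ, matN, Matrix.GeneralLinearGroup.mkOfDetNeZero, Matrix.mul_apply,
      Fin.sum_univ_two, Algebra.smul_def, mul_assoc]

theorem unit_mul_inv_coe (u : (𝓞 F)ˣ) :
    ((u : 𝓞 F) : F) * (((u⁻¹ : (𝓞 F)ˣ) : 𝓞 F) : F) = 1 := by
  rw [← map_mul, Units.mul_inv, map_one]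

theorem matUZN_mul (ε η ε' η' : (𝓞 F)ˣ) (b b' : F) :
    matU ε * matZ η * matN b * (matU ε' * matZ η' * matN b') =
      matU (ε * ε') * matZ (η * η') * matN ((((ε'⁻¹ : (𝓞 F)ˣ) : 𝓞 F) : F) * b + b') := by
  apply Units.ext
  rw [Units.val_mul, matUZN_val, matUZN_val, matUZN_val]
  have h := unit_mul_inv_coe ε'
  ext i j
  fin_cases i <;> fin_cases j <;> simp [Matrix.mul_apply, Fin.sum_univ_two]
  · ring
  · field_simp
    ring

/-- The parabolic subgroup `Γ_∞ = U(Γ) Z(Γ) N(Γ)`. -/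
def GammaInf (𝔠 : FractionalIdeal (𝓞 F)⁰ F) : Subgroup (GL (Fin 2) F) where
  carrier := {γ | ∃ ε ∈ totPosUnits F, ∃ η : (𝓞 F)ˣ, ∃ b ∈ (𝔠 * different F)⁻¹,
    γ = matU ε * matZ η * matN b}
  one_mem' := by
    refine ⟨1, one_mem _, 1, 0, FractionalIdeal.zero_mem _, ?_⟩
    apply Units.ext
    rw [matUZN_val]
    simp [Matrix.one_fin_two]
  mul_mem' := by
    rintro _ _ ⟨ε, hε, η, b, hb, rfl⟩ ⟨ε', hε', η', b', hb', rfl⟩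
    exact ⟨ε * ε', mul_mem hε hε', η * η', _,
      Submodule.add_mem _ (unit_smul_mem _ _ hb) hb', matUZN_mul _ _ _ _ _ _⟩
  inv_mem' := by
    rintro _ ⟨ε, hε, η, b, hb, rfl⟩
    refine ⟨ε⁻¹, inv_mem hε, η⁻¹, -((ε : 𝓞 F) : F) * b, ?_, ?_⟩
    · rw [neg_mul]; exact Submodule.neg_mem _ (unit_smul_mem _ _ hb)
    · rw [inv_eq_iff_mul_eq_one, matUZN_mul]
      apply Units.ext
      rw [matUZN_val]
      simp [Matrix.one_fin_two]

end Groups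

section Forms

variable {F : Type*} [Field F] {d : ℕ} (σ : Fin d ≃ (F →+* ℝ))

/-- The product `ℍ^d` of `d` upper half-planes, inside `ℂ^d`. Functions on `ℍ^d` are written as
functions on `ℂ^d` of which only the values on this set matter. -/
def upperHalf (d : ℕ) : Set (Fin d → ℂ) := {z | ∀ i, 0 < (z i).im}

/-- `e(νz) = exp(2πi Tr(νz))`, with `Tr(νz) = ∑ ν_i z_i`. -/
def expTr (ν : F) (z : Fin d → ℂ) : ℂ :=
  Complex.exp (2 * Real.pi * Complex.I * ∑ i, ((σ i ν : ℝ) : ℂ) * z i)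

/-- Componentwise Möbius action. -/
def moebius (γ : GL (Fin 2) F) (z : Fin d → ℂ) : Fin d → ℂ := fun i =>
  (((σ i (γ 0 0) : ℝ) : ℂ) * z i + ((σ i (γ 0 1) : ℝ) : ℂ)) /
    (((σ i (γ 1 0) : ℝ) : ℂ) * z i + ((σ i (γ 1 1) : ℝ) : ℂ))

/-- `a ^ (k / 2) = ∏ a_i ^ (k_i / 2)` for totally positive `a`. -/
def halfPow (a : F) (k : Fin d → ℕ) : ℝ := ∏ i, (σ i a) ^ ((k i : ℝ) / 2)

/-- The slash operator `(φ|_k γ)(z) = det(γ)^{k/2} N(cz+d)^{-k} φ(γz)`, for `γ` of totally positive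
determinant. -/
def slash (k : Fin d → ℕ) (γ : GL (Fin 2) F) (φ : (Fin d → ℂ) → ℂ) (z : Fin d → ℂ) : ℂ :=
  (halfPow σ γ.val.det k : ℂ) *
    (∏ i, (((σ i (γ 1 0) : ℝ) : ℂ) * z i + ((σ i (γ 1 1) : ℝ) : ℂ)) ^ k i)⁻¹ *
    φ (moebius σ γ z)

/-- `φ` is invariant, on `ℍ^d`, under the weight `k` action of the group `G`. -/
def IsInvariant (k : Fin d → ℕ) (G : Subgroup (GL (Fin 2) F)) (φ : (Fin d → ℂ) → ℂ) : Prop :=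
  ∀ γ ∈ G, ∀ z ∈ upperHalf d, slash σ k γ φ z = φ z

variable [NumberField F]

/-- `f` is a Hilbert modular form of weight `k` for `Γ₀(𝔠, 𝔫)`: it is holomorphic on `ℍ^d` and
invariant under the weight `k` action. (For `d > 1` no condition at the cusps is needed.) -/
def IsModularForm (k : Fin d → ℕ) (𝔠 : FractionalIdeal (𝓞 F)⁰ F) (𝔫 : Ideal (𝓞 F))
    (f : (Fin d → ℂ) → ℂ) : Prop :=
  DifferentiableOn ℂ f (upperHalf d) ∧ IsInvariant σ k (Gamma0 𝔠 𝔫) f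

/-- `f` is a cusp form: the constant term of its Fourier expansion at every cusp vanishes. The cusps
are the points `A∞` with `A ∈ SL₂(F)`, and the Fourier expansion of `f` at `A∞` is the expansion of
`f|_k A` as an absolutely convergent series `∑ a(ν) e(νz)`, with `ν` in some lattice of `F`. -/
def IsCuspForm (k : Fin d → ℕ) (𝔠 : FractionalIdeal (𝓞 F)⁰ F) (𝔫 : Ideal (𝓞 F))
    (f : (Fin d → ℂ) → ℂ) : Prop :=
  IsModularForm σ k 𝔠 𝔫 f ∧
    ∀ A : Matrix.SpecialLinearGroup (Fin 2) F,
      ∃ (J : FractionalIdeal (𝓞 F)⁰ F) (a : F → ℂ), a 0 = 0 ∧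
        ∀ z ∈ upperHalf d, HasSum (fun ν : {ν : F // ν ∈ J} => a ν * expTr σ (ν : F) z)
          (slash σ k (A : GL (Fin 2) F) f z)

/-- The coset space `Γ_∞ \ Γ`, for `Γ = Γ₀(𝔠, 𝔫)`. -/
abbrev Cosets (𝔠 : FractionalIdeal (𝓞 F)⁰ F) (𝔫 : Ideal (𝓞 F)) : Type _ :=
  Quotient (QuotientGroup.rightRel ((GammaInf 𝔠).subgroupOf (Gamma0 𝔠 𝔫)))

/-- The summand `φ|_k M` of the Poincaré series at a coset `Γ_∞ M`. It does not depend on the chosen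
representative `M` when `φ` is invariant under `Γ_∞`. -/
def poincareTerm (k : Fin d → ℕ) (𝔠 : FractionalIdeal (𝓞 F)⁰ F) (𝔫 : Ideal (𝓞 F))
    (φ : (Fin d → ℂ) → ℂ) (q : Cosets 𝔠 𝔫) (z : Fin d → ℂ) : ℂ :=
  slash σ k (q.out : GL (Fin 2) F) φ z

/-- The Hilbert Poincaré series `ℙ_k(φ; z) = ∑_{M ∈ Γ_∞ \ Γ} (φ|_k M)(z)` of a `Γ_∞`-invariant seed
function `φ`. -/
def poincareSeries (k : Fin d → ℕ) (𝔠 : FractionalIdeal (𝓞 F)⁰ F) (𝔫 : Ideal (𝓞 F))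
    (φ : (Fin d → ℂ) → ℂ) (z : Fin d → ℂ) : ℂ :=
  ∑' q : Cosets 𝔠 𝔫, poincareTerm σ k 𝔠 𝔫 φ q z

/-- The series `ℙ_k(φ)` is well defined: the seed is invariant under `Γ_∞`, and the series converges
absolutely and locally uniformly on `ℍ^d`. -/
def PoincareWellDefined (k : Fin d → ℕ) (𝔠 : FractionalIdeal (𝓞 F)⁰ F) (𝔫 : Ideal (𝓞 F))
    (φ : (Fin d → ℂ) → ℂ) : Prop :=
  IsInvariant σ k (GammaInf 𝔠) φ ∧
    (∀ z ∈ upperHalf d, Summable fun q : Cosets 𝔠 𝔫 => ‖poincareTerm σ k 𝔠 𝔫 φ q z‖) ∧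
    HasSumLocallyUniformlyOn (poincareTerm σ k 𝔠 𝔫 φ) (poincareSeries σ k 𝔠 𝔫 φ) (upperHalf d)

/-- The sum `∑_{ε ∈ 𝓞^{×+}} φ|_k diag(ε, 1)` of the translates of `φ` by `U(Γ)`. -/
def unitSum (k : Fin d → ℕ) (φ : (Fin d → ℂ) → ℂ) (z : Fin d → ℂ) : ℂ :=
  ∑' ε : totPosUnits F, slash σ k (matU (ε : (𝓞 F)ˣ)) φ z

/-- The seed `∑_{ν ∈ μ𝓞^{×+}} (ν/μ)^{k/2} e(νz)` of `P_μ`, written with `ν = εμ`. -/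
def seedP (k : Fin d → ℕ) (μ : F) (z : Fin d → ℂ) : ℂ :=
  ∑' ε : totPosUnits F, (halfPow σ (((ε : (𝓞 F)ˣ) : 𝓞 F) : F) k : ℂ) *
    expTr σ ((((ε : (𝓞 F)ˣ) : 𝓞 F) : F) * μ) z

/-- The Hilbert Poincaré series `P_μ(z; k, 𝔠, 𝔫)`. -/
def poincareP (k : Fin d → ℕ) (𝔠 : FractionalIdeal (𝓞 F)⁰ F) (𝔫 : Ideal (𝓞 F)) (μ : F) :
    (Fin d → ℂ) → ℂ :=
  poincareSeries σ k 𝔠 𝔫 (seedP σ k μ)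

end Forms

section Bracket

variable {d : ℕ}

/-- The complex partial derivative `∂g/∂z_i`. -/
def partialDeriv (i : Fin d) (g : (Fin d → ℂ) → ℂ) (z : Fin d → ℂ) : ℂ :=
  deriv (fun t : ℂ => g (Function.update z i t)) (z i)

/-- The mixed derivative `g^{(l)} = ∂^{l_1 + ... + l_d} g / ∂z_1^{l_1} ... ∂z_d^{l_d}`. -/
def mixedDeriv (l : Fin d → ℕ) (g : (Fin d → ℂ) → ℂ) : (Fin d → ℂ) → ℂ :=
  (List.finRange d).foldr (fun i h => (partialDeriv i)^[l i] h) g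

/-- The coefficient `(-1)^{|l|} C(k₁+n-1, n-l) C(k₂+n-1, l)`, with componentwise binomials. -/
def bracketCoeff (k₁ k₂ n l : Fin d → ℕ) : ℂ :=
  (-1) ^ (∑ i, l i) * (∏ i, ((k₁ i + n i - 1).choose (n i - l i) : ℂ)) *
    ∏ i, ((k₂ i + n i - 1).choose (l i) : ℂ)

/-- The `n`-th Rankin-Cohen bracket `[f₁, f₂]_n` of functions of weights `k₁` and `k₂`. -/
def rankinCohen (k₁ k₂ n : Fin d → ℕ) (f₁ f₂ : (Fin d → ℂ) → ℂ) (z : Fin d → ℂ) : ℂ :=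
  ∑ l ∈ Finset.Icc 0 n, bracketCoeff k₁ k₂ n l * mixedDeriv l f₁ z * mixedDeriv (n - l) f₂ z

/-- The function
`φ(z) = e(μz) ∑_{0 ≤ l ≤ n} (-1)^{|l|} C(k₁+n-1, n-l) C(k₂+n-1, l) N(2πiμ)^{n-l} f^{(l)}(z)`. -/
def bracketSeed {F : Type*} [Field F] (σ : Fin d ≃ (F →+* ℝ)) (k₁ k₂ n : Fin d → ℕ) (μ : F)
    (f : (Fin d → ℂ) → ℂ) (z : Fin d → ℂ) : ℂ :=
  expTr σ μ z * ∑ l ∈ Finset.Icc 0 n, bracketCoeff k₁ k₂ n l *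
    (∏ i, (2 * Real.pi * Complex.I * ((σ i μ : ℝ) : ℂ)) ^ (n i - l i)) * mixedDeriv l f z

end Bracket

end

end HilbertPoincare

namespace HilbertPoincare

open Filter Topology Metric Set

/-! ### Partial derivatives of separately holomorphic, locally bounded functions. -/

section SeparatelyHolomorphic

variable {d : ℕ}

/-! Both seeds are sums over totally positive units of slashes of one function: `expTr σ μ` for
`P_μ`, and `bracketSeed` for the other series. Together with the sum over cosets this gives a single
sum over `(ZN) \ Γ`, where `Z` consists of the scalars and `N` of the translations. Exponentials are
eigenfunctions of all `∂/∂z_i`, so `φ = [f, e(μz)]_n` (`bracketSeed_eq`). The bracket commutes with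
slashing (`rankinCohen_slash`) and `f|γ = f`, hence `φ|γ = [f, e(μz)|γ]_n` for every `γ ∈ Γ`.
Summing over `γ` and pulling the differential operator `[f, ·]_n` out of the sum gives the theorem.

Equivariance of the bracket factors over the variables into `sum_slashCoeff_mul`, which comes down
to the vanishing of the alternating sum of the binomials `C(N, m)` for `N > 0`.

Exchanging sum and derivatives requires local majorants. For the exponential terms they come from
`locSummable_slash_expTr`: after scaling by units the determinants lie in a finite set, and `γ`
modulo `ZN` is then known from its determinant and bottom row, essentially a pair of algebraic
integers. The norm of a term is a product over the places of `s^k exp(-b s²)` with `s = √det /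
|cz+e|`; the exponential controls the places where `cz+e` is small, and `k ≥ 3` leaves a summable
product of powers `-3/2`. Cauchy's estimate transfers the majorants to all derivatives
(`LocSummable.mixedDeriv`), so the series of `φ̃` inherits its convergence from that of `P_μ`. -/

theorem isOpen_upperHalf : IsOpen (upperHalf d) := by
  simp only [upperHalf, Set.ofPred_forall]
  exact isOpen_iInter_of_finite fun i =>
    isOpen_lt continuous_const (Complex.continuous_im.comp (continuous_apply i))

theorem update_mem_upperHalf {z : Fin d → ℂ} (hz : z ∈ upperHalf d) {i : Fin d} {t : ℂ}
    (ht : 0 < t.im) : Function.update z i t ∈ upperHalf d := by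
  intro j
  rcases eq_or_ne j i with rfl | h
  · simpa using ht
  · simpa [h] using hz j

theorem isOpen_im_pos : IsOpen {t : ℂ | 0 < t.im} :=
  isOpen_lt continuous_const Complex.continuous_im

/-- `g` is holomorphic in each variable separately, and locally bounded, on `ℍ^d`. -/
structure SepHol (g : (Fin d → ℂ) → ℂ) : Prop where
  diff : ∀ z ∈ upperHalf d, ∀ i,
    DifferentiableAt ℂ (fun t => g (Function.update z i t)) (z i)
  bdd : ∀ z ∈ upperHalf d, ∃ C : ℝ, ∀ᶠ w in 𝓝 z, ‖g w‖ ≤ C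

theorem SepHol.slice {g : (Fin d → ℂ) → ℂ} (hg : SepHol g) {z : Fin d → ℂ}
    (hz : z ∈ upperHalf d) (i : Fin d) :
    DifferentiableOn ℂ (fun t => g (Function.update z i t)) {t | 0 < t.im} := by
  intro t ht
  have h := hg.diff _ (update_mem_upperHalf (i := i) hz ht) i
  simp only [Function.update_idem, Function.update_self] at h
  exact h.differentiableWithinAt

theorem eventually_slice {p : (Fin d → ℂ) → Prop} {z : Fin d → ℂ} (i : Fin d)
    (h : ∀ᶠ w in 𝓝 z, p w) : ∀ᶠ t in 𝓝 (z i), p (Function.update z i t) := by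
  have hc : ContinuousAt (fun t => Function.update z i t) (z i) :=
    (continuous_const.update i continuous_id).continuousAt
  have h' := hc.eventually (p := p) (by simpa using h)
  exact h'

theorem partialDeriv_congr {g h : (Fin d → ℂ) → ℂ} (hgh : EqOn g h (upperHalf d)) (i : Fin d) :
    EqOn (partialDeriv i g) (partialDeriv i h) (upperHalf d) := by
  intro z hz
  refine Filter.EventuallyEq.deriv_eq ?_
  exact eventually_slice i ((isOpen_upperHalf.eventually_mem hz).mono fun w hw => hgh hw)

theorem iterate_partialDeriv_congr {g h : (Fin d → ℂ) → ℂ} (hgh : EqOn g h (upperHalf d))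
    (i : Fin d) (m : ℕ) :
    EqOn ((partialDeriv i)^[m] g) ((partialDeriv i)^[m] h) (upperHalf d) := by
  induction m with
  | zero => exact hgh
  | succ m ih =>
    rw [Function.iterate_succ_apply', Function.iterate_succ_apply']
    exact partialDeriv_congr ih i

theorem mixedDeriv_congr {g h : (Fin d → ℂ) → ℂ} (hgh : EqOn g h (upperHalf d))
    (l : Fin d → ℕ) : EqOn (mixedDeriv l g) (mixedDeriv l h) (upperHalf d) := by
  unfold mixedDeriv
  induction List.finRange d with
  | nil => exact hgh
  | cons i L ih => exact iterate_partialDeriv_congr ih i _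

theorem differentiable_update (z : Fin d → ℂ) (i : Fin d) :
    Differentiable ℂ (fun t : ℂ => Function.update z i t) := by
  rw [differentiable_pi]
  intro j
  rcases eq_or_ne j i with rfl | h
  · simp
  · simp [h]

theorem SepHol.of_differentiableOn {g : (Fin d → ℂ) → ℂ}
    (hg : DifferentiableOn ℂ g (upperHalf d)) : SepHol g where
  diff z hz i := by
    have h := hg.differentiableAt (isOpen_upperHalf.mem_nhds hz)
    refine DifferentiableAt.comp (z i) ?_ (differentiable_update z i (z i))
    simp [h]
  bdd z hz := by
    have h := (hg.differentiableAt (isOpen_upperHalf.mem_nhds hz)).continuousAt.norm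
    exact ⟨‖g z‖ + 1, (h.eventually (gt_mem_nhds (lt_add_one _))).mono fun w hw => hw.le⟩

theorem exists_ball_of_eventually {p : (Fin d → ℂ) → Prop} {z : Fin d → ℂ}
    (hz : z ∈ upperHalf d) (h : ∀ᶠ w in 𝓝 z, p w) :
    ∃ r > 0, ball z r ⊆ upperHalf d ∧ ∀ w ∈ ball z r, p w := by
  obtain ⟨r, hr, h'⟩ := Metric.eventually_nhds_iff_ball.1
    (h.and (isOpen_upperHalf.eventually_mem hz))
  exact ⟨r, hr, fun w hw => (h' w hw).2, fun w hw => (h' w hw).1⟩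

theorem update_mem_ball {z w : Fin d → ℂ} {r : ℝ} (hw : w ∈ ball z (r / 2)) {i : Fin d} {t : ℂ}
    (ht : t ∈ closedBall (w i) (r / 2)) : Function.update w i t ∈ ball z r := by
  have hr : 0 < r := by linarith [dist_nonneg.trans_lt hw]
  rw [mem_ball, dist_pi_lt_iff hr]
  intro j
  have h1 : dist (w j) (z j) < r / 2 := (dist_le_pi_dist w z j).trans_lt hw
  rcases eq_or_ne j i with rfl | h
  · rw [Function.update_self]
    linarith [dist_triangle t (w j) (z j), mem_closedBall.1 ht]
  · rw [Function.update_of_ne h]; linarith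

theorem closedBall_subset_im_pos {z w : Fin d → ℂ} {r : ℝ} (hr : ball z r ⊆ upperHalf d)
    (hw : w ∈ ball z (r / 2)) (i : Fin d) : closedBall (w i) (r / 2) ⊆ {t | 0 < t.im} := by
  intro t ht
  have := hr (update_mem_ball hw ht) i
  simpa using this

theorem SepHol.norm_partialDeriv_le {g : (Fin d → ℂ) → ℂ} (hg : SepHol g) {z : Fin d → ℂ}
    {r C : ℝ} (hr : ball z r ⊆ upperHalf d) (hC : ∀ w ∈ ball z r, ‖g w‖ ≤ C) (i : Fin d)
    {w : Fin d → ℂ} (hw : w ∈ ball z (r / 2)) : ‖partialDeriv i g w‖ ≤ C / (r / 2) := by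
  have hr0 : 0 < r / 2 := dist_nonneg.trans_lt hw
  have hwH : w ∈ upperHalf d := hr (ball_subset_ball (by linarith) hw)
  refine Complex.norm_deriv_le_of_forall_mem_sphere_norm_le hr0 ?_ fun t ht =>
    hC _ (update_mem_ball hw (sphere_subset_closedBall ht))
  refine DifferentiableOn.diffContOnCl ?_
  rw [closure_ball _ hr0.ne']
  exact (hg.slice hwH i).mono (closedBall_subset_im_pos hr hw i)

/-- The Schwarz-type bound for `dslope` is applied twice, first to `g` and then to its slope. The
resulting constant depends only on `C` and `ρ`, which makes the convergence of slopes uniform in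
parameters. -/
theorem norm_slope_sub_deriv_le {g : ℂ → ℂ} {s : ℂ} {ρ C : ℝ}
    (hg : DifferentiableOn ℂ g (ball s ρ)) (hC : ∀ w ∈ ball s ρ, ‖g w‖ ≤ C) {w : ℂ}
    (hw : w ∈ ball s ρ) :
    ‖dslope g s w - deriv g s‖ ≤ 2 * (2 * C / ρ) / ρ * ‖w - s‖ := by
  have hρ : 0 < ρ := dist_nonneg.trans_lt hw
  have hs : s ∈ ball s ρ := mem_ball_self hρ
  have h1 : ∀ w ∈ ball s ρ, ‖dslope g s w‖ ≤ 2 * C / ρ := fun w hw => by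
    refine Complex.norm_dslope_le_div_of_mapsTo_ball hg (fun t ht => ?_) hw
    rw [mem_closedBall, dist_eq_norm]
    linarith [norm_sub_le (g t) (g s), hC t ht, hC s hs]
  have h2 : DifferentiableOn ℂ (dslope g s) (ball s ρ) :=
    (Complex.differentiableOn_dslope (isOpen_ball.mem_nhds hs)).2 hg
  have h3 : ‖dslope (dslope g s) s w‖ ≤ 2 * (2 * C / ρ) / ρ := by
    refine Complex.norm_dslope_le_div_of_mapsTo_ball h2 (fun t ht => ?_) hw
    rw [mem_closedBall, dist_eq_norm]
    linarith [norm_sub_le (dslope g s t) (dslope g s s), h1 t ht, h1 s hs]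
  have h4 := sub_smul_dslope (dslope g s) s w
  rw [dslope_same] at h4
  rw [← h4, norm_smul, mul_comm]
  gcongr

/-- Difference quotients in the variable `j` converge to the partial derivative, locally uniformly
in the variable `i`. -/
theorem SepHol.tendsto_slope {g : (Fin d → ℂ) → ℂ} (hg : SepHol g) {z : Fin d → ℂ}
    (hz : z ∈ upperHalf d) {i j : Fin d} (hij : i ≠ j) :
    ∃ ρ > 0, ball (z i) ρ ⊆ {t | 0 < t.im} ∧
      (∀ᶠ h in 𝓝[≠] (0 : ℂ), 0 < (z j + h).im) ∧
      TendstoLocallyUniformlyOn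
        (fun (h : ℂ) (t : ℂ) => h⁻¹ * (g (Function.update (Function.update z i t) j (z j + h)) -
          g (Function.update z i t)))
        (fun t => partialDeriv j g (Function.update z i t)) (𝓝[≠] 0) (ball (z i) ρ) := by
  obtain ⟨C, hC⟩ := hg.bdd z hz
  obtain ⟨r, hr0, hr, hC⟩ := exists_ball_of_eventually hz hC
  have hzr : z ∈ ball z (r / 2) := mem_ball_self (by linarith)
  have him : ∀ᶠ h in 𝓝[≠] (0 : ℂ), ‖h‖ < r / 2 :=
    nhdsWithin_le_nhds (((continuous_norm (E := ℂ)).tendsto' 0 0 norm_zero).eventually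
      (gt_mem_nhds (show (0 : ℝ) < r / 2 by linarith)))
  have hnear : ∀ {h : ℂ}, ‖h‖ < r / 2 → z j + h ∈ ball (z j) (r / 2) := fun {h} hh => by
    simpa [dist_eq_norm] using hh
  refine ⟨r / 2, by linarith, ball_subset_closedBall.trans (closedBall_subset_im_pos hr hzr i),
    ?_, ?_⟩
  · filter_upwards [him] with h hh
    exact closedBall_subset_im_pos hr hzr j (ball_subset_closedBall (hnear hh))
  · refine TendstoUniformlyOn.tendstoLocallyUniformlyOn ?_
    rw [Metric.tendstoUniformlyOn_iff]
    intro ε hε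
    set K : ℝ := 2 * (2 * C / (r / 2)) / (r / 2) with hK
    have hKε : ∀ᶠ h in 𝓝[≠] (0 : ℂ), K * ‖h‖ < ε :=
      nhdsWithin_le_nhds ((Continuous.tendsto' (f := fun h : ℂ => K * ‖h‖) (by fun_prop) 0 0
        (by simp)).eventually (gt_mem_nhds hε))
    filter_upwards [him, hKε, self_mem_nhdsWithin] with h hh hKh hh0 t ht
    have htz : Function.update z i t ∈ upperHalf d :=
      update_mem_upperHalf hz (closedBall_subset_im_pos hr hzr i (ball_subset_closedBall ht))
    have hmem : ∀ s ∈ ball (z j) (r / 2),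
        Function.update (Function.update z i t) j s ∈ ball z r := by
      intro s hs
      rw [mem_ball, dist_pi_lt_iff hr0]
      intro k
      rcases eq_or_ne k j with rfl | hk
      · rw [Function.update_self]; linarith [mem_ball.1 hs]
      · rw [Function.update_of_ne hk]
        rcases eq_or_ne k i with rfl | hk'
        · rw [Function.update_self]; linarith [mem_ball.1 ht]
        · rw [Function.update_of_ne hk', dist_self]; exact hr0
    have key := norm_slope_sub_deriv_le (s := z j) (ρ := r / 2) (C := C)
      (g := fun s => g (Function.update (Function.update z i t) j s))
      ((hg.slice htz j).mono
        (ball_subset_closedBall.trans (closedBall_subset_im_pos hr hzr j)))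
      (fun s hs => hC _ (hmem s hs)) (hnear hh)
    rw [dslope_of_ne _ (by simpa using hh0), slope_def_module] at key
    have hj : Function.update z i t j = z j := Function.update_of_ne hij.symm _ _
    have hj' : Function.update (Function.update z i t) j (z j) = Function.update z i t := by
      rw [← hj, Function.update_eq_self]
    rw [hj', add_sub_cancel_left, smul_eq_mul, ← hK] at key
    rw [dist_comm, dist_eq_norm, partialDeriv, hj]
    exact key.trans_lt hKh

theorem SepHol.slope_differentiableOn {g : (Fin d → ℂ) → ℂ} (hg : SepHol g) {z : Fin d → ℂ}
    (hz : z ∈ upperHalf d) {i j : Fin d} (hij : i ≠ j) {h : ℂ} (hh : 0 < (z j + h).im) :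
    DifferentiableOn ℂ (fun t => h⁻¹ *
      (g (Function.update (Function.update z i t) j (z j + h)) - g (Function.update z i t)))
      {t | 0 < t.im} := by
  have h1 := hg.slice (update_mem_upperHalf (i := j) hz hh) i
  simp_rw [Function.update_comm hij]
  exact (h1.sub (hg.slice hz i)).const_mul _

/-- In a variable `i ≠ j` the derivative is a locally uniform limit of difference quotients, each
holomorphic in that variable. Local boundedness is Cauchy's estimate on a ball of half the radius.
-/
theorem SepHol.partialDeriv {g : (Fin d → ℂ) → ℂ} (hg : SepHol g) (j : Fin d) :
    SepHol (partialDeriv j g) where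
  diff z hz i := by
    rcases eq_or_ne i j with rfl | hij
    · have h := (hg.slice hz i).deriv isOpen_im_pos
      simpa [HilbertPoincare.partialDeriv, Function.update_idem] using
        h.differentiableAt (isOpen_im_pos.mem_nhds (hz i))
    · obtain ⟨ρ, hρ, hsub, hev, hlim⟩ := hg.tendsto_slope hz hij
      refine (hlim.differentiableOn ?_ isOpen_ball).differentiableAt (ball_mem_nhds _ hρ)
      filter_upwards [hev] with h hh
      exact (hg.slope_differentiableOn hz hij hh).mono hsub
  bdd z hz := by
    obtain ⟨C, hC⟩ := hg.bdd z hz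
    obtain ⟨r, hr0, hr, hC⟩ := exists_ball_of_eventually hz hC
    refine ⟨C / (r / 2), ?_⟩
    filter_upwards [ball_mem_nhds z (show 0 < r / 2 by linarith)] with w hw
    exact hg.norm_partialDeriv_le hr hC j hw

/-- By Weierstrass, the locally uniform limit of difference quotients in `j` may be differentiated
in `i`. The differentiated quotients are the difference quotients in `j` of `∂g/∂z_i`, and limits
are unique. -/
theorem SepHol.partialDeriv_comm {g : (Fin d → ℂ) → ℂ} (hg : SepHol g) (i j : Fin d) :
    EqOn (HilbertPoincare.partialDeriv i (HilbertPoincare.partialDeriv j g))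
      (HilbertPoincare.partialDeriv j (HilbertPoincare.partialDeriv i g)) (upperHalf d) := by
  intro z hz
  rcases eq_or_ne i j with rfl | hij
  · rfl
  obtain ⟨ρ, hρ, hsub, hev, hlim⟩ := hg.tendsto_slope hz hij
  have hd : ∀ᶠ h in 𝓝[≠] (0 : ℂ), DifferentiableOn ℂ (fun t => h⁻¹ *
      (g (Function.update (Function.update z i t) j (z j + h)) - g (Function.update z i t)))
      (ball (z i) ρ) := by
    filter_upwards [hev] with h hh
    exact (hg.slope_differentiableOn hz hij hh).mono hsub
  have h1 := (hlim.deriv hd isOpen_ball).tendsto_at (mem_ball_self hρ)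
  refine tendsto_nhds_unique h1 ?_
  have h2 := ((hg.partialDeriv i).diff z hz j).hasDerivAt
  rw [hasDerivAt_iff_tendsto_slope_zero] at h2
  refine h2.congr' ?_
  filter_upwards [hev] with h hh
  have e1 : DifferentiableAt ℂ
      (fun t => g (Function.update (Function.update z j (z j + h)) i t)) (z i) :=
    (hg.slice (update_mem_upperHalf hz hh) i).differentiableAt (isOpen_im_pos.mem_nhds (hz i))
  have e2 := hg.diff z hz i
  simp only [Function.comp, HilbertPoincare.partialDeriv, Function.update_eq_self, smul_eq_mul,
    Function.update_comm hij, Function.update_of_ne hij]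
  rw [deriv_const_mul_field, deriv_fun_sub e1 e2]

theorem SepHol.iterate {g : (Fin d → ℂ) → ℂ} (hg : SepHol g) (i : Fin d) (m : ℕ) :
    SepHol ((HilbertPoincare.partialDeriv i)^[m] g) := by
  induction m with
  | zero => exact hg
  | succ m ih => rw [Function.iterate_succ_apply']; exact ih.partialDeriv i

theorem SepHol.foldr {g : (Fin d → ℂ) → ℂ} (hg : SepHol g) (l : Fin d → ℕ) (L : List (Fin d)) :
    SepHol (L.foldr (fun i h => (HilbertPoincare.partialDeriv i)^[l i] h) g) := by
  induction L with
  | nil => exact hg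
  | cons i L ih => exact ih.iterate i _

theorem SepHol.mixedDeriv {g : (Fin d → ℂ) → ℂ} (hg : SepHol g) (l : Fin d → ℕ) :
    SepHol (mixedDeriv l g) := hg.foldr l _

theorem SepHol.iterate_comm {g : (Fin d → ℂ) → ℂ} (hg : SepHol g) (i j : Fin d) (m : ℕ) :
    EqOn ((HilbertPoincare.partialDeriv i)^[m] (HilbertPoincare.partialDeriv j g))
      (HilbertPoincare.partialDeriv j ((HilbertPoincare.partialDeriv i)^[m] g))
      (upperHalf d) := by
  induction m with
  | zero => exact fun _ _ => rfl
  | succ m ih =>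
    rw [Function.iterate_succ_apply', Function.iterate_succ_apply']
    exact (partialDeriv_congr ih i).trans ((hg.iterate i m).partialDeriv_comm i j)

theorem SepHol.mixedDeriv_add_single {g : (Fin d → ℂ) → ℂ} (hg : SepHol g) (l : Fin d → ℕ)
    (j : Fin d) :
    EqOn (HilbertPoincare.mixedDeriv (l + Pi.single j 1) g)
      (HilbertPoincare.partialDeriv j (HilbertPoincare.mixedDeriv l g)) (upperHalf d) := by
  -- In a list without duplicates `j` occurs at most once. A tail without `j` does not see the extra
  -- derivative; at `j` it appears outermost, and it is then commuted past the remaining variables.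
  have key : ∀ L : List (Fin d), L.Nodup →
      (j ∉ L → L.foldr (fun i h => (HilbertPoincare.partialDeriv i)^[(l + Pi.single j 1 : Fin d → ℕ) i] h) g =
        L.foldr (fun i h => (HilbertPoincare.partialDeriv i)^[l i] h) g) ∧
      (j ∈ L → EqOn
        (L.foldr (fun i h => (HilbertPoincare.partialDeriv i)^[(l + Pi.single j 1 : Fin d → ℕ) i] h) g)
        (HilbertPoincare.partialDeriv j
          (L.foldr (fun i h => (HilbertPoincare.partialDeriv i)^[l i] h) g)) (upperHalf d)) := by
    intro L
    induction L with
    | nil => simp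
    | cons i L ih =>
      intro hL
      obtain ⟨hi, hL⟩ := List.nodup_cons.1 hL
      obtain ⟨ih1, ih2⟩ := ih hL
      refine ⟨fun hj => ?_, fun hj => ?_⟩
      · rw [List.mem_cons, not_or] at hj
        rw [List.foldr_cons, List.foldr_cons, ih1 hj.2]
        simp [Pi.single_eq_of_ne (Ne.symm hj.1)]
      · rw [List.foldr_cons, List.foldr_cons]
        rcases eq_or_ne j i with rfl | hji
        · rw [ih1 hi]
          simp [Function.iterate_succ_apply', Set.eqOn_refl]
        · have hjL : j ∈ L := (List.mem_cons.1 hj).resolve_left hji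
          have h0 : (l + Pi.single j 1 : Fin d → ℕ) i = l i := by
            simp [Pi.single_eq_of_ne (Ne.symm hji)]
          rw [h0]
          exact (iterate_partialDeriv_congr (ih2 hjL) i _).trans
            ((hg.foldr l L).iterate_comm i j _)
  exact (key _ (List.nodup_finRange d)).2 (List.mem_finRange j)

theorem mixedDeriv_zero (g : (Fin d → ℂ) → ℂ) : mixedDeriv 0 g = g := by
  unfold mixedDeriv
  induction List.finRange d with
  | nil => rfl
  | cons i L ih => rw [List.foldr_cons, ih]; rfl

end SeparatelyHolomorphic

/-! ### Locally normally convergent series and termwise differentiation. -/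

section Sums

variable {d : ℕ} {ι : Type*}

/-- The family `G` has, locally on `ℍ^d`, a summable majorant. -/
def LocSummable (G : ι → (Fin d → ℂ) → ℂ) : Prop :=
  ∀ z ∈ upperHalf d, ∃ u : ι → ℝ, Summable u ∧ ∀ᶠ w in 𝓝 z, ∀ i, ‖G i w‖ ≤ u i

theorem LocSummable.summable_norm {G : ι → (Fin d → ℂ) → ℂ} (hG : LocSummable G)
    {z : Fin d → ℂ} (hz : z ∈ upperHalf d) : Summable fun i => ‖G i z‖ := by
  obtain ⟨u, hu, h⟩ := hG z hz
  exact Summable.of_nonneg_of_le (fun _ => norm_nonneg _) h.self_of_nhds hu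

theorem LocSummable.partialDeriv {G : ι → (Fin d → ℂ) → ℂ} (hG : LocSummable G)
    (hS : ∀ i, SepHol (G i)) (j : Fin d) : LocSummable fun i => partialDeriv j (G i) := by
  intro z hz
  obtain ⟨u, hu, h⟩ := hG z hz
  obtain ⟨r, hr0, hr, h⟩ := exists_ball_of_eventually hz h
  refine ⟨fun i => u i / (r / 2), hu.div_const _, ?_⟩
  filter_upwards [ball_mem_nhds z (show 0 < r / 2 by linarith)] with w hw i
  exact (hS i).norm_partialDeriv_le hr (fun w hw => h w hw i) j hw

theorem LocSummable.partialDeriv_tsum {G : ι → (Fin d → ℂ) → ℂ} (hG : LocSummable G)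
    (hS : ∀ i, SepHol (G i)) (j : Fin d) :
    EqOn (HilbertPoincare.partialDeriv j fun z => ∑' i, G i z)
      (fun z => ∑' i, HilbertPoincare.partialDeriv j (G i) z) (upperHalf d) := by
  intro z hz
  obtain ⟨u, hu, h⟩ := hG z hz
  obtain ⟨r, hr0, hr⟩ := Metric.eventually_nhds_iff_ball.1
    ((eventually_slice j h).and (isOpen_im_pos.eventually_mem (hz j)))
  exact (Complex.hasSum_deriv_of_summable_norm
    (F := fun i t => G i (Function.update z j t)) hu
    (fun i => ((hS i).slice hz j).mono fun t ht => (hr t ht).2) isOpen_ball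
    (fun i t ht => (hr t ht).1 i) (mem_ball_self hr0)).tsum_eq.symm

/-- The two claims are proved together because each termwise differentiation needs a majorant for
the derivatives already taken. -/
theorem LocSummable.mixedDeriv {G : ι → (Fin d → ℂ) → ℂ} (hG : LocSummable G)
    (hS : ∀ i, SepHol (G i)) (l : Fin d → ℕ) :
    LocSummable (fun i => mixedDeriv l (G i)) ∧
    EqOn (HilbertPoincare.mixedDeriv l fun z => ∑' i, G i z)
      (fun z => ∑' i, HilbertPoincare.mixedDeriv l (G i) z) (upperHalf d) := by
  have h1 : ∀ (G : ι → (Fin d → ℂ) → ℂ), LocSummable G → (∀ i, SepHol (G i)) → ∀ (j : Fin d)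
      (m : ℕ), LocSummable (fun i => (HilbertPoincare.partialDeriv j)^[m] (G i)) ∧
      EqOn ((HilbertPoincare.partialDeriv j)^[m] fun z => ∑' i, G i z)
        (fun z => ∑' i, (HilbertPoincare.partialDeriv j)^[m] (G i) z) (upperHalf d) := by
    intro G hG hS j m
    induction m with
    | zero => exact ⟨hG, fun _ _ => rfl⟩
    | succ m ih =>
      simp only [Function.iterate_succ_apply']
      exact ⟨ih.1.partialDeriv (fun i => (hS i).iterate j m) j,
        (partialDeriv_congr ih.2 j).trans
          (ih.1.partialDeriv_tsum (fun i => (hS i).iterate j m) j)⟩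
  unfold HilbertPoincare.mixedDeriv
  induction List.finRange d with
  | nil => exact ⟨hG, fun _ _ => rfl⟩
  | cons j L ih =>
    simp only [List.foldr_cons]
    obtain ⟨h2, h3⟩ := h1 _ ih.1 (fun i => (hS i).foldr l L) j (l j)
    exact ⟨h2, (iterate_partialDeriv_congr ih.2 j _).trans h3⟩

end Sums

/-! ### The Möbius action, its automorphy factor and the slash operators. -/

section Slash

variable {F : Type*} [Field F] {d : ℕ} {σ : Fin d ≃ (F →+* ℝ)}

/-- The denominator `c_i w + e_i` of the Möbius action in the `i`-th variable. -/
noncomputable def denom (σ : Fin d ≃ (F →+* ℝ)) (γ : GL (Fin 2) F) (i : Fin d) (w : ℂ) : ℂ :=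
  ((σ i (γ 1 0) : ℝ) : ℂ) * w + ((σ i (γ 1 1) : ℝ) : ℂ)

/-- All conjugates of the determinant of `γ` are positive. -/
def PosDet (σ : Fin d ≃ (F →+* ℝ)) (γ : GL (Fin 2) F) : Prop := ∀ i, 0 < σ i γ.val.det

theorem conj_det (γ : GL (Fin 2) F) (i : Fin d) : σ i γ.val.det =
    σ i (γ 0 0) * σ i (γ 1 1) - σ i (γ 0 1) * σ i (γ 1 0) := by
  rw [Matrix.det_fin_two, map_sub, map_mul, map_mul]

theorem denom_ne_zero {γ : GL (Fin 2) F} (hγ : PosDet σ γ) {i : Fin d} {w : ℂ} (hw : 0 < w.im) :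
    denom σ γ i w ≠ 0 := by
  intro h
  have h1 : σ i (γ 1 0) * w.im = 0 := by simpa [denom] using congrArg Complex.im h
  have h2 : σ i (γ 1 0) = 0 := by simpa [hw.ne'] using h1
  have h3 : σ i (γ 1 1) = 0 := by simpa [denom, h2] using h
  have h4 := hγ i
  rw [conj_det, h2, h3] at h4
  simp at h4

theorem moebius_apply (γ : GL (Fin 2) F) (z : Fin d → ℂ) (i : Fin d) : moebius σ γ z i =
    (((σ i (γ 0 0) : ℝ) : ℂ) * z i + ((σ i (γ 0 1) : ℝ) : ℂ)) / denom σ γ i (z i) := rfl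

theorem moebius_im (γ : GL (Fin 2) F) (z : Fin d → ℂ) (i : Fin d) :
    (moebius σ γ z i).im = σ i γ.val.det * (z i).im / Complex.normSq (denom σ γ i (z i)) := by
  rw [moebius_apply, Complex.div_im, conj_det]
  simp only [denom, Complex.add_im, Complex.add_re, Complex.mul_im, Complex.mul_re,
    Complex.ofReal_im, Complex.ofReal_re]
  ring

theorem moebius_mem {γ : GL (Fin 2) F} (hγ : PosDet σ γ) {z : Fin d → ℂ}
    (hz : z ∈ upperHalf d) : moebius σ γ z ∈ upperHalf d := fun i => by
  rw [moebius_im]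
  exact div_pos (mul_pos (hγ i) (hz i)) (Complex.normSq_pos.2 (denom_ne_zero hγ (hz i)))

theorem denom_mul (γ δ : GL (Fin 2) F) {z : Fin d → ℂ} {i : Fin d}
    (h : denom σ δ i (z i) ≠ 0) :
    denom σ (γ * δ) i (z i) = denom σ γ i (moebius σ δ z i) * denom σ δ i (z i) := by
  rw [moebius_apply, denom, denom, add_mul, mul_assoc, div_mul_cancel₀ _ h]
  simp only [denom, Units.val_mul, Matrix.mul_apply, Fin.sum_univ_two, map_add, map_mul,
    Complex.ofReal_add, Complex.ofReal_mul]
  ring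

theorem moebius_mul {γ δ : GL (Fin 2) F} (hγ : PosDet σ γ) (hδ : PosDet σ δ) {z : Fin d → ℂ}
    (hz : z ∈ upperHalf d) : moebius σ (γ * δ) z = moebius σ γ (moebius σ δ z) := by
  funext i
  have h1 : denom σ δ i (z i) ≠ 0 := denom_ne_zero hδ (hz i)
  have h2 : denom σ γ i (moebius σ δ z i) ≠ 0 := denom_ne_zero hγ (moebius_mem hδ hz i)
  rw [moebius_apply, denom_mul _ _ h1, moebius_apply γ, div_eq_div_iff (mul_ne_zero h2 h1) h2,
    mul_comm (denom σ γ i _) (denom σ δ i _), ← mul_assoc]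
  congr 1
  rw [moebius_apply, add_mul, mul_assoc _ (_ / _), div_mul_cancel₀ _ h1]
  simp only [denom, Units.val_mul, Matrix.mul_apply, Fin.sum_univ_two, map_add, map_mul,
    Complex.ofReal_add, Complex.ofReal_mul]
  ring

theorem halfPow_mul {a b : F} (ha : ∀ i, 0 < σ i a) (hb : ∀ i, 0 < σ i b) (k : Fin d → ℕ) :
    halfPow σ (a * b) k = halfPow σ a k * halfPow σ b k := by
  simp only [halfPow, map_mul, ← Finset.prod_mul_distrib]
  exact Finset.prod_congr rfl fun i _ => Real.mul_rpow (ha i).le (hb i).le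

theorem slash_apply (k : Fin d → ℕ) (γ : GL (Fin 2) F) (φ : (Fin d → ℂ) → ℂ) (z : Fin d → ℂ) :
    slash σ k γ φ z =
      (halfPow σ γ.val.det k : ℂ) * (∏ i, denom σ γ i (z i) ^ k i)⁻¹ * φ (moebius σ γ z) := rfl

theorem slash_slash {γ δ : GL (Fin 2) F} (hγ : PosDet σ γ) (hδ : PosDet σ δ) (k : Fin d → ℕ)
    (φ : (Fin d → ℂ) → ℂ) {z : Fin d → ℂ} (hz : z ∈ upperHalf d) :
    slash σ k δ (slash σ k γ φ) z = slash σ k (γ * δ) φ z := by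
  have h : ∏ i, denom σ (γ * δ) i (z i) ^ k i =
      (∏ i, denom σ γ i (moebius σ δ z i) ^ k i) * ∏ i, denom σ δ i (z i) ^ k i := by
    rw [← Finset.prod_mul_distrib]
    exact Finset.prod_congr rfl fun i _ => by
      rw [denom_mul _ _ (denom_ne_zero hδ (hz i)), mul_pow]
  rw [slash_apply, slash_apply, slash_apply, moebius_mul hγ hδ hz, h, Units.val_mul,
    Matrix.det_mul, halfPow_mul hγ hδ, mul_inv]
  push_cast
  ring

theorem slash_congr {φ ψ : (Fin d → ℂ) → ℂ} (h : EqOn φ ψ (upperHalf d)) {γ : GL (Fin 2) F}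
    (hγ : PosDet σ γ) (k : Fin d → ℕ) :
    EqOn (slash σ k γ φ) (slash σ k γ ψ) (upperHalf d) := fun z hz => by
  rw [slash_apply, slash_apply, h (moebius_mem hγ hz)]

theorem slash_tsum {ι : Type*} (k : Fin d → ℕ) (γ : GL (Fin 2) F) (φ : ι → (Fin d → ℂ) → ℂ)
    (z : Fin d → ℂ) :
    slash σ k γ (fun z => ∑' i, φ i z) z = ∑' i, slash σ k γ (φ i) z := by
  simp only [slash_apply, tsum_mul_left]

theorem differentiable_denom (γ : GL (Fin 2) F) (i : Fin d) :
    Differentiable ℂ fun z : Fin d → ℂ => denom σ γ i (z i) :=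
  (((differentiable_apply i).const_mul _).add_const _)

theorem differentiableOn_slash {φ : (Fin d → ℂ) → ℂ} (h : DifferentiableOn ℂ φ (upperHalf d))
    {γ : GL (Fin 2) F} (hγ : PosDet σ γ) (k : Fin d → ℕ) :
    DifferentiableOn ℂ (slash σ k γ φ) (upperHalf d) := by
  have h1 : DifferentiableOn ℂ (moebius σ γ) (upperHalf d) := by
    rw [differentiableOn_pi]
    intro i
    have h0 : Differentiable ℂ fun z : Fin d → ℂ =>
        ((σ i (γ 0 0) : ℝ) : ℂ) * z i + ((σ i (γ 0 1) : ℝ) : ℂ) :=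
      ((differentiable_apply i).const_mul _).add_const _
    simp only [moebius_apply, div_eq_mul_inv]
    exact h0.differentiableOn.fun_mul ((differentiable_denom γ i).differentiableOn.fun_inv
      fun z hz => denom_ne_zero hγ (hz i))
  have h2 : Differentiable ℂ (fun z : Fin d → ℂ => ∏ i, denom σ γ i (z i) ^ k i) := by
    induction (Finset.univ : Finset (Fin d)) using Finset.cons_induction with
    | empty => simp
    | cons i s hi ih =>
      simp only [Finset.prod_cons]
      exact ((differentiable_denom γ i).fun_pow _).fun_mul ih
  have h3 : ∀ z ∈ upperHalf d, ∏ i, denom σ γ i (z i) ^ k i ≠ 0 := fun z hz =>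
    Finset.prod_ne_zero_iff.2 fun i _ => pow_ne_zero _ (denom_ne_zero hγ (hz i))
  exact ((h2.differentiableOn.inv h3).const_mul _).mul
    (h.comp h1 fun z hz => moebius_mem hγ hz)

end Slash

/-! ### One-variable coefficient identities. -/

section RankinCohen

/-- The coefficient of `f^{(r)}(γz)` in the `l`-th derivative of `(cz+e)^{-k} f(γz)`, where
`D = det γ` and `j = cz+e`. -/
noncomputable def slashCoeff (c D : ℂ) (k l r : ℕ) (j : ℂ) : ℂ :=
  (l.choose r : ℂ) * ((k + l - 1).factorial / (k + r - 1).factorial) * (-c) ^ (l - r) * D ^ r *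
    (j ^ (k + l + r))⁻¹

theorem slashCoeff_of_lt (c D : ℂ) (k : ℕ) {l r : ℕ} (h : l < r) (j : ℂ) :
    slashCoeff c D k l r j = 0 := by
  simp [slashCoeff, Nat.choose_eq_zero_of_lt h]

theorem slashCoeff_zero (c D : ℂ) (k : ℕ) (j : ℂ) : slashCoeff c D k 0 0 j = (j ^ k)⁻¹ := by
  have : ((k - 1).factorial : ℂ) ≠ 0 := Nat.cast_ne_zero.2 (Nat.factorial_ne_zero _)
  simp [slashCoeff, this]

theorem hasDerivAt_slashCoeff (c e D : ℂ) (k l r : ℕ) {w : ℂ} (hw : c * w + e ≠ 0) :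
    HasDerivAt (fun t => slashCoeff c D k l r (c * t + e))
      (-(k + l + r : ℕ) * c / (c * w + e) * slashCoeff c D k l r (c * w + e)) w := by
  have h1 : HasDerivAt (fun t => c * t + e) c w := by
    simpa using ((hasDerivAt_id w).const_mul c).add_const e
  have h2 := ((h1.pow (k + l + r)).inv (pow_ne_zero _ hw)).const_mul
    ((l.choose r : ℂ) * ((k + l - 1).factorial / (k + r - 1).factorial) * (-c) ^ (l - r) * D ^ r)
  refine h2.congr_deriv ?_
  rw [slashCoeff]
  generalize (l.choose r : ℂ) * ((k + l - 1).factorial / (k + r - 1).factorial) * (-c) ^ (l - r) *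
    D ^ r = A
  rcases Nat.eq_zero_or_pos (k + l + r) with h | h
  · simp [h]
  · obtain ⟨m, hm⟩ := Nat.exists_eq_succ_of_ne_zero h.ne'
    rw [hm]
    simp only [Pi.pow_apply, Nat.succ_eq_add_one, Nat.add_sub_cancel]
    field_simp
    ring

/-- The undifferentiated `f` arises only by differentiating its own coefficient. Positivity of `k`
matters because `(k + r - 1)!` uses truncated subtraction. -/
theorem slashCoeff_succ_zero (c D : ℂ) {k : ℕ} (hk : 0 < k) (l : ℕ) {j : ℂ} (hj : j ≠ 0) :
    slashCoeff c D k (l + 1) 0 j = -(k + l + 0 : ℕ) * c / j * slashCoeff c D k l 0 j := by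
  obtain ⟨q, rfl⟩ := Nat.exists_eq_succ_of_ne_zero hk.ne'
  have e1 : q.succ + (l + 1) - 1 = q + l + 1 := by omega
  have e2 : q.succ + l - 1 = q + l := by omega
  simp only [slashCoeff, e1, e2, Nat.factorial_succ, Nat.choose_zero_right, Nat.sub_zero]
  field_simp
  push_cast
  ring

/-- The product rule in terms of coefficients: the first summand differentiates the coefficient of
`f^{(r+1)}`, the second is the chain rule applied to `f^{(r)}(γz)`, where `γ` has derivative `D /
j²`. -/
theorem slashCoeff_succ_succ (c D : ℂ) {k : ℕ} (hk : 0 < k) (l r : ℕ) {j : ℂ} (hj : j ≠ 0) :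
    slashCoeff c D k (l + 1) (r + 1) j =
      -(k + l + (r + 1) : ℕ) * c / j * slashCoeff c D k l (r + 1) j +
        D / j ^ 2 * slashCoeff c D k l r j := by
  obtain ⟨q, rfl⟩ := Nat.exists_eq_succ_of_ne_zero hk.ne'
  have e1 : q.succ + (l + 1) - 1 = q + l + 1 := by omega
  have e2 : q.succ + l - 1 = q + l := by omega
  have e3 : q.succ + (r + 1) - 1 = q + r + 1 := by omega
  have e4 : q.succ + r - 1 = q + r := by omega
  have f1 : ((q + r).factorial : ℂ) ≠ 0 := Nat.cast_ne_zero.2 (Nat.factorial_ne_zero _)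
  have f2 : ((q + r + 1 : ℕ) : ℂ) ≠ 0 := Nat.cast_ne_zero.2 (by omega)
  simp only [slashCoeff, e1, e2, e3, e4]
  rcases lt_trichotomy l r with h | rfl | h
  · rw [Nat.choose_eq_zero_of_lt (show l + 1 < r + 1 by omega),
      Nat.choose_eq_zero_of_lt (show l < r + 1 by omega), Nat.choose_eq_zero_of_lt h]
    simp
  · rw [Nat.choose_self, Nat.choose_self, Nat.choose_eq_zero_of_lt (show l < l + 1 by omega)]
    have f3 : ((q + l + 1).factorial : ℂ) ≠ 0 := Nat.cast_ne_zero.2 (Nat.factorial_ne_zero _)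
    rw [div_self f1, div_self f3]
    simp only [Nat.sub_self, pow_zero, Nat.cast_zero, Nat.cast_one, zero_mul, mul_zero, zero_add,
      one_mul]
    field_simp
    ring
  · obtain ⟨m, rfl⟩ := Nat.exists_eq_add_of_lt h
    have e5 : r + m + 1 + 1 - (r + 1) = m + 1 := by omega
    have e6 : r + m + 1 - (r + 1) = m := by omega
    have e7 : r + m + 1 - r = m + 1 := by omega
    rw [e5, e6, e7]
    -- This relation and Pascal's rule `hp` are the only facts about binomials that the recursion
    -- needs.
    have hc : ((r + m + 1).choose (r + 1) : ℂ) * (r + 1) = (r + m + 1).choose r * (m + 1) := by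
      have := Nat.choose_succ_right_eq (r + m + 1) r
      rw [e7] at this
      exact_mod_cast this
    have hp : ((r + m + 1 + 1).choose (r + 1) : ℂ) =
        (r + m + 1).choose r + (r + m + 1).choose (r + 1) := by
      exact_mod_cast Nat.choose_succ_succ (r + m + 1) r
    have p1 : q.succ + (r + m + 1 + 1) + (r + 1) = q.succ + (r + m + 1) + r + 2 := by omega
    have p2 : q.succ + (r + m + 1) + (r + 1) = q.succ + (r + m + 1) + r + 1 := by omega
    rw [p1, p2, pow_add j _ 2, pow_succ j (q.succ + (r + m + 1) + r)]
    have hX : j ^ (q.succ + (r + m + 1) + r) ≠ 0 := pow_ne_zero _ hj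
    generalize j ^ (q.succ + (r + m + 1) + r) = X at hX
    rw [hp, Nat.factorial_succ (q + (r + m + 1)), Nat.factorial_succ (q + r)]
    push_cast at f2 ⊢
    field_simp
    linear_combination -((q + (r + m + 1)).factorial : ℂ) * D ^ (r + 1) * (-c) ^ (m + 1) * hc

/-- The identity behind the equivariance of the Rankin-Cohen bracket in one variable. -/
theorem sum_slashCoeff_mul (c D : ℂ) {k₁ k₂ : ℕ} (hk₁ : 0 < k₁) (hk₂ : 0 < k₂) (n r s : ℕ)
    (hr : r ≤ n) (hs : s ≤ n) (j : ℂ) :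
    ∑ l ∈ Finset.Icc 0 n, (-1) ^ l * ((k₁ + n - 1).choose (n - l) : ℂ) *
      ((k₂ + n - 1).choose l : ℂ) * slashCoeff c D k₁ l r j * slashCoeff c D k₂ (n - l) s j =
    if s = n - r then (-1) ^ r * ((k₁ + n - 1).choose (n - r) : ℂ) *
      ((k₂ + n - 1).choose r : ℂ) * D ^ n * (j ^ (k₁ + k₂ + 2 * n))⁻¹ else 0 := by
  -- If `r + s > n`, every `l` has `l < r` or `n - l < s`, so every term vanishes. Otherwise `n = r
  -- + s + N`, and the condition `s = n - r` becomes `N = 0`.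
  rcases lt_or_ge n (r + s) with h | h
  · rw [if_neg (by omega)]
    refine Finset.sum_eq_zero fun l hl => ?_
    rcases lt_or_ge l r with h1 | h1
    · rw [slashCoeff_of_lt _ _ _ h1]; simp
    · rw [slashCoeff_of_lt _ _ _ (show n - l < s by omega)]; simp
  obtain ⟨N, rfl⟩ := Nat.exists_eq_add_of_le h
  obtain ⟨q₁, rfl⟩ := Nat.exists_eq_succ_of_ne_zero hk₁.ne'
  obtain ⟨q₂, rfl⟩ := Nat.exists_eq_succ_of_ne_zero hk₂.ne'
  -- With `l = r + m`, all factorials depending on `m` cancel except those of `C(N, m)`, and the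
  -- powers of `-c`, `D` and `j` do not depend on `m`. Thus `A` factors out and `∑ (-1)^m C(N, m)`
  -- remains.
  set A : ℂ := (-1) ^ r * ((q₁ + (r + s + N)).factorial * (q₂ + (r + s + N)).factorial) /
    (r.factorial * s.factorial * (q₁ + r).factorial * (q₂ + s).factorial * N.factorial) *
    (-c) ^ N * D ^ (r + s) * (j ^ (q₁.succ + q₂.succ + (2 * r + 2 * s + N)))⁻¹ with hA
  have hf : ∀ m : ℕ, (m.factorial : ℂ) ≠ 0 := fun m => Nat.cast_ne_zero.2 m.factorial_ne_zero
  have hterm : ∀ m ∈ Finset.range (N + 1), A * ((-1) ^ m * (N.choose m : ℂ)) =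
      (-1) ^ (r + m) * ((q₁.succ + (r + s + N) - 1).choose (r + s + N - (r + m)) : ℂ) *
      ((q₂.succ + (r + s + N) - 1).choose (r + m) : ℂ) * slashCoeff c D q₁.succ (r + m) r j *
      slashCoeff c D q₂.succ (r + s + N - (r + m)) s j := by
    intro m hm
    obtain ⟨p, rfl⟩ := Nat.exists_eq_add_of_le (Nat.lt_succ_iff.1 (Finset.mem_range.1 hm))
    have e1 : r + s + (m + p) - (r + m) = s + p := by omega
    have e2 : q₁.succ + (r + s + (m + p)) - 1 = (s + p) + (q₁ + r + m) := by omega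
    have e3 : q₂.succ + (r + s + (m + p)) - 1 = (r + m) + (q₂ + s + p) := by omega
    have e4 : q₁.succ + (r + m) - 1 = q₁ + r + m := by omega
    have e5 : q₁.succ + r - 1 = q₁ + r := by omega
    have e6 : q₂.succ + (s + p) - 1 = q₂ + s + p := by omega
    have e7 : q₂.succ + s - 1 = q₂ + s := by omega
    have e8 : q₁ + (r + s + (m + p)) = (s + p) + (q₁ + r + m) := by omega
    have e9 : q₂ + (r + s + (m + p)) = (r + m) + (q₂ + s + p) := by omega
    rw [hA, slashCoeff, slashCoeff, e1, e2, e3, e4, e5, e6, e7, e8, e9,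
      Nat.cast_add_choose, Nat.cast_add_choose, Nat.cast_add_choose, Nat.cast_add_choose,
      Nat.cast_add_choose, Nat.add_sub_cancel_left, Nat.add_sub_cancel_left]
    have e10 : q₁.succ + q₂.succ + (2 * r + 2 * s + (m + p)) =
      (q₁.succ + (r + m) + r) + (q₂.succ + (s + p) + s) := by omega
    rw [e10, pow_add j, mul_inv]
    have g1 := hf r
    have g2 := hf s
    have g3 := hf (q₁ + r)
    have g4 := hf (q₂ + s)
    have g5 := hf (m + p)
    have g6 := hf m
    have g7 := hf p
    have g8 := hf (s + p)
    have g9 := hf (r + m)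
    have g10 := hf (q₁ + r + m)
    have g11 := hf (q₂ + s + p)
    generalize (j ^ (q₁.succ + (r + m) + r))⁻¹ = j1
    generalize (j ^ (q₂.succ + (s + p) + s))⁻¹ = j2
    field_simp
    ring
  rw [← Finset.sum_of_injOn (fun m => r + m) (fun a _ b _ hab => by simpa using hab)
    (s := Finset.range (N + 1)) (fun m hm => by simp at hm ⊢; omega) (fun l hl hl' => ?_) hterm]
  · rw [← Finset.mul_sum]
    have halt : ∑ m ∈ Finset.range (N + 1), (-1 : ℂ) ^ m * (N.choose m : ℂ) =
        if N = 0 then 1 else 0 := by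
      exact_mod_cast congrArg (Int.cast : ℤ → ℂ) (Int.alternating_sum_range_choose (n := N))
    rw [halt]
    rcases Nat.eq_zero_or_pos N with rfl | hN
    · rw [if_pos rfl, if_pos (by omega), hA]
      have e1 : q₁.succ + (r + s + 0) - 1 = s + (q₁ + r) := by omega
      have e2 : q₂.succ + (r + s + 0) - 1 = r + (q₂ + s) := by omega
      have e3 : r + s + 0 - r = s := by omega
      have e4 : q₁ + (r + s + 0) = s + (q₁ + r) := by omega
      have e5 : q₂ + (r + s + 0) = r + (q₂ + s) := by omega
      have e6 : q₁.succ + q₂.succ + (2 * r + 2 * s + 0) =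
        q₁.succ + q₂.succ + 2 * (r + s + 0) := by omega
      rw [e1, e2, e3, e4, e5, e6, Nat.cast_add_choose, Nat.cast_add_choose]
      have g1 := hf r
      have g2 := hf s
      have g3 := hf (q₁ + r)
      have g4 := hf (q₂ + s)
      generalize (j ^ (q₁.succ + q₂.succ + 2 * (r + s + 0)))⁻¹ = j1
      simp only [Nat.factorial_zero, Nat.cast_one, pow_zero, add_zero]
      field_simp
    · rw [if_neg hN.ne', if_neg (by omega), mul_zero]
  · simp only [Set.mem_image, Finset.coe_range, Set.mem_Iio, not_exists, not_and] at hl'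
    rcases lt_or_ge l r with h1 | h1
    · rw [slashCoeff_of_lt _ _ _ h1]; simp
    · rw [Finset.mem_Icc] at hl
      have hlt : N < l - r := by
        by_contra hcon
        exact hl' (l - r) (by omega) (by omega)
      rw [slashCoeff_of_lt _ _ _ (show r + s + N - l < s by omega)]; simp

end RankinCohen

/-! ### Equivariance of the bracket in several variables. -/

section Equivariance

variable {F : Type*} [Field F] {d : ℕ} {σ : Fin d ≃ (F →+* ℝ)}

/-- The product over all variables of the coefficients `slashCoeff`. -/
noncomputable def slashCoeffProd (σ : Fin d ≃ (F →+* ℝ)) (γ : GL (Fin 2) F) (s : Finset (Fin d))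
    (k l r : Fin d → ℕ) (z : Fin d → ℂ) : ℂ :=
  ∏ i ∈ s, slashCoeff (σ i (γ 1 0) : ℝ) (σ i γ.val.det : ℝ) (k i) (l i) (r i) (denom σ γ i (z i))

theorem moebius_update (γ : GL (Fin 2) F) (z : Fin d → ℂ) (j : Fin d) (t : ℂ) :
    moebius σ γ (Function.update z j t) = Function.update (moebius σ γ z) j
      ((((σ j (γ 0 0) : ℝ) : ℂ) * t + ((σ j (γ 0 1) : ℝ) : ℂ)) / denom σ γ j t) := by
  funext i
  rcases eq_or_ne i j with rfl | h
  · simp [moebius_apply]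
  · simp [moebius_apply, h]

theorem hasDerivAt_denom (γ : GL (Fin 2) F) (j : Fin d) (w : ℂ) :
    HasDerivAt (denom σ γ j) (σ j (γ 1 0) : ℝ) w := by
  have h := ((hasDerivAt_id w).const_mul ((σ j (γ 1 0) : ℝ) : ℂ)).add_const
    ((σ j (γ 1 1) : ℝ) : ℂ)
  rw [mul_one] at h
  exact h

theorem hasDerivAt_moebius {γ : GL (Fin 2) F} (hγ : PosDet σ γ) (j : Fin d) {w : ℂ}
    (hw : 0 < w.im) :
    HasDerivAt (fun t => (((σ j (γ 0 0) : ℝ) : ℂ) * t + ((σ j (γ 0 1) : ℝ) : ℂ)) / denom σ γ j t)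
      ((σ j γ.val.det : ℝ) / denom σ γ j w ^ 2) w := by
  have h1 : HasDerivAt (fun t => ((σ j (γ 0 0) : ℝ) : ℂ) * t + ((σ j (γ 0 1) : ℝ) : ℂ))
      (σ j (γ 0 0) : ℝ) w := by
    simpa using ((hasDerivAt_id w).const_mul ((σ j (γ 0 0) : ℝ) : ℂ)).add_const
      ((σ j (γ 0 1) : ℝ) : ℂ)
  refine (h1.fun_div (hasDerivAt_denom γ j w) (denom_ne_zero hγ hw)).congr_deriv ?_
  rw [conj_det, denom]
  push_cast
  ring

theorem hasDerivAt_slashCoeffProd_mul {γ : GL (Fin 2) F} (hγ : PosDet σ γ) (k l r : Fin d → ℕ)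
    {f : (Fin d → ℂ) → ℂ} (hf : SepHol f) {z : Fin d → ℂ} (hz : z ∈ upperHalf d) (j : Fin d) :
    HasDerivAt (fun t => slashCoeffProd σ γ Finset.univ k l r (Function.update z j t) *
        f (moebius σ γ (Function.update z j t)))
      (slashCoeffProd σ γ (Finset.univ.erase j) k l r z *
        (-(k j + l j + r j : ℕ) * (σ j (γ 1 0) : ℝ) / denom σ γ j (z j) *
          slashCoeff (σ j (γ 1 0) : ℝ) (σ j γ.val.det : ℝ) (k j) (l j) (r j)
            (denom σ γ j (z j)) * f (moebius σ γ z) +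
        (σ j γ.val.det : ℝ) / denom σ γ j (z j) ^ 2 *
          slashCoeff (σ j (γ 1 0) : ℝ) (σ j γ.val.det : ℝ) (k j) (l j) (r j)
            (denom σ γ j (z j)) * partialDeriv j f (moebius σ γ z))) (z j) := by
  have h1 : ∀ t, slashCoeffProd σ γ Finset.univ k l r (Function.update z j t) =
      slashCoeff (σ j (γ 1 0) : ℝ) (σ j γ.val.det : ℝ) (k j) (l j) (r j) (denom σ γ j t) *
      slashCoeffProd σ γ (Finset.univ.erase j) k l r z := by
    intro t
    rw [slashCoeffProd, ← Finset.mul_prod_erase _ _ (Finset.mem_univ j), Function.update_self]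
    congr 1
    refine Finset.prod_congr rfl fun i hi => ?_
    rw [Function.update_of_ne (Finset.ne_of_mem_erase hi)]
  simp only [h1, moebius_update]
  have h2 := hasDerivAt_slashCoeff (σ j (γ 1 0) : ℝ) (σ j (γ 1 1) : ℝ) (σ j γ.val.det : ℝ)
    (k j) (l j) (r j) (denom_ne_zero (σ := σ) hγ (hz j))
  have h3 := hasDerivAt_moebius hγ j (hz j)
  have h4 := (hf.diff _ (moebius_mem hγ hz) j).hasDerivAt
  have h5 := HasDerivAt.comp (z j) h4 h3
  refine ((h2.mul_const (slashCoeffProd σ γ (Finset.univ.erase j) k l r z)).fun_mul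
    h5).congr_deriv ?_
  have h6 : Function.update (moebius σ γ z) j ((((σ j (γ 0 0) : ℝ) : ℂ) * z j +
      ((σ j (γ 0 1) : ℝ) : ℂ)) / denom σ γ j (z j)) = moebius σ γ z := by
    rw [← moebius_update, Function.update_eq_self]
  simp only [Function.comp, h6]
  rw [partialDeriv]
  simp only [denom]
  ring

theorem slashCoeffProd_of_not_le {k l r : Fin d → ℕ} {γ : GL (Fin 2) F} {z : Fin d → ℂ}
    (h : ¬ r ≤ l) : slashCoeffProd σ γ Finset.univ k l r z = 0 := by
  rw [Pi.le_def, not_forall] at h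
  obtain ⟨i, hi⟩ := h
  exact Finset.prod_eq_zero (Finset.mem_univ i) (slashCoeff_of_lt _ _ _ (not_le.1 hi) _)

/-- Induction on `|l|`. One more `∂/∂z_j` splits each term by the product rule, and the two families
recombine through the recursions `slashCoeff_succ_zero` and `slashCoeff_succ_succ` in the `j`-th
factor alone. -/
theorem mixedDeriv_slash {γ : GL (Fin 2) F} (hγ : PosDet σ γ) {k : Fin d → ℕ}
    (hk : ∀ i, 0 < k i) {f : (Fin d → ℂ) → ℂ} (hf : DifferentiableOn ℂ f (upperHalf d))
    (l : Fin d → ℕ) :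
    EqOn (mixedDeriv l (slash σ k γ f)) (fun z => (halfPow σ γ.val.det k : ℂ) *
      ∑ r ∈ Finset.Icc 0 l, slashCoeffProd σ γ Finset.univ k l r z *
        mixedDeriv r f (moebius σ γ z)) (upperHalf d) := by
  have hfS : SepHol f := .of_differentiableOn hf
  have hsS : SepHol (slash σ k γ f) := .of_differentiableOn (differentiableOn_slash hf hγ k)
  have hind : ∀ m : ℕ, ∀ l : Fin d → ℕ, ∑ i, l i = m →
      EqOn (mixedDeriv l (slash σ k γ f)) (fun z => (halfPow σ γ.val.det k : ℂ) *
      ∑ r ∈ Finset.Icc 0 l, slashCoeffProd σ γ Finset.univ k l r z *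
        mixedDeriv r f (moebius σ γ z)) (upperHalf d) := by
    intro m
    induction m with
    | zero =>
      intro l hl z hz
      obtain rfl : l = 0 := by
        funext i
        exact (Finset.sum_eq_zero_iff.1 hl) i (Finset.mem_univ i)
      simp [mixedDeriv_zero, slashCoeffProd, slash_apply, slashCoeff_zero, mul_assoc]
    | succ m ih =>
      intro l' hl'
      obtain ⟨j, hj⟩ : ∃ j, l' j ≠ 0 := by
        by_contra! hcon
        simp [hcon] at hl'
      obtain ⟨l, rfl⟩ : ∃ l, l' = l + Pi.single j 1 := by
        refine ⟨l' - Pi.single j 1, (tsub_add_cancel_of_le ?_).symm⟩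
        intro i
        rcases eq_or_ne i j with rfl | h
        · simpa using Nat.one_le_iff_ne_zero.2 hj
        · simp [h]
      have hl : ∑ i, l i = m := by
        simpa [Finset.sum_add_distrib, Finset.sum_pi_single'] using hl'
      intro z hz
      rw [hsS.mixedDeriv_add_single l j hz, partialDeriv_congr (ih l hl) j hz]
      have hD := (HasDerivAt.fun_sum (u := Finset.Icc 0 l) fun r _ =>
        hasDerivAt_slashCoeffProd_mul hγ k l r (hfS.mixedDeriv r) hz j).const_mul
        (halfPow σ γ.val.det k : ℂ)
      rw [partialDeriv, hD.deriv]
      simp only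
      congr 1
      set E : (Fin d → ℕ) → ℂ := fun r => slashCoeffProd σ γ (Finset.univ.erase j) k l r z with hE
      set c : ℂ := ((σ j (γ 1 0) : ℝ) : ℂ)
      set D : ℂ := ((σ j γ.val.det : ℝ) : ℂ)
      set J : ℂ := denom σ γ j (z j) with hJ
      have hJ0 : J ≠ 0 := denom_ne_zero hγ (hz j)
      have hprod : ∀ r, slashCoeffProd σ γ Finset.univ k (l + Pi.single j 1) r z =
          slashCoeff c D (k j) (l j + 1) (r j) J * E r := by
        intro r
        rw [slashCoeffProd, ← Finset.mul_prod_erase _ _ (Finset.mem_univ j)]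
        congr 1
        · simp [c, D, hJ]
        · refine Finset.prod_congr rfl fun i hi => ?_
          simp [Finset.ne_of_mem_erase hi]
      have hEzero : ∀ r, slashCoeff c D (k j) (l j) (r j) J * E r =
          slashCoeffProd σ γ Finset.univ k l r z := by
        intro r
        rw [slashCoeffProd, ← Finset.mul_prod_erase _ _ (Finset.mem_univ j)]
        rfl
      have hEadd : ∀ r, E (r + Pi.single j 1) = E r := by
        intro r
        refine Finset.prod_congr rfl fun i hi => ?_
        simp [Finset.ne_of_mem_erase hi]
      set G : (Fin d → ℕ) → ℂ := fun r => mixedDeriv r f (moebius σ γ z) with hG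
      have hGadd : ∀ r, partialDeriv j (mixedDeriv r f) (moebius σ γ z) = G (r + Pi.single j 1) :=
        fun r => (hfS.mixedDeriv_add_single r j (moebius_mem hγ hz)).symm
      set A : (Fin d → ℕ) → ℂ := fun r => -(k j + l j + r j : ℕ) * c / J *
        (slashCoeff c D (k j) (l j) (r j) J * E r) * G r with hA
      set B : (Fin d → ℕ) → ℂ := fun r => D / J ^ 2 *
        (slashCoeff c D (k j) (l j) (r j) J * E r) * G (r + Pi.single j 1) with hB
      -- The chain rule terms `B`, reindexed by the order of the derivative of `f` they contain. No
      -- such term has order `0` in the variable `j`, so that case is set to `0` rather than left to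
      -- `r j - 1 = 0`.
      set B' : (Fin d → ℕ) → ℂ := fun r => if r j = 0 then 0 else
        D / J ^ 2 * (slashCoeff c D (k j) (l j) (r j - 1) J * E r) * G r with hB'
      have hAs : ∑ r ∈ Finset.Icc 0 l, A r = ∑ r ∈ Finset.Icc 0 (l + Pi.single j 1), A r := by
        refine Finset.sum_subset (Finset.Icc_subset_Icc_right le_self_add) fun r _ hr => ?_
        rw [Finset.mem_Icc, not_and] at hr
        simp only [hA]
        rw [hEzero, slashCoeffProd_of_not_le (hr (zero_le))]
        simp
      have hBs : ∑ r ∈ Finset.Icc 0 l, B r = ∑ r ∈ Finset.Icc 0 (l + Pi.single j 1), B' r := by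
        refine Finset.sum_of_injOn (fun r => r + Pi.single j 1)
          (fun a _ b _ hab => add_right_cancel hab) ?_ ?_ ?_
        · intro r hr
          rw [Finset.mem_coe, Finset.mem_Icc] at hr ⊢
          exact ⟨zero_le, add_le_add_left hr.2 _⟩
        · intro r hr hr'
          simp only [hB']
          refine if_pos ?_
          by_contra hrj
          refine hr' ⟨r - Pi.single j 1, ?_, tsub_add_cancel_of_le ?_⟩
          · rw [Finset.mem_coe, Finset.mem_Icc]
            exact ⟨zero_le, tsub_le_iff_right.2 (Finset.mem_Icc.1 hr).2⟩
          · intro i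
            rcases eq_or_ne i j with rfl | h
            · simpa using Nat.one_le_iff_ne_zero.2 hrj
            · simp [h]
        · intro r _
          simp [hB, hB', hEadd]
      have hL : ∀ r, slashCoeffProd σ γ (Finset.univ.erase j) k l r z *
          (-(k j + l j + r j : ℕ) * c / J * slashCoeff c D (k j) (l j) (r j) J *
            mixedDeriv r f (moebius σ γ z) +
          D / J ^ 2 * slashCoeff c D (k j) (l j) (r j) J *
            partialDeriv j (mixedDeriv r f) (moebius σ γ z)) = A r + B r := by
        intro r
        rw [hGadd]
        simp only [hA, hB, hE, hG]
        ring
      rw [Finset.sum_congr rfl fun r _ => hL r, Finset.sum_add_distrib, hAs, hBs,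
        ← Finset.sum_add_distrib]
      refine Finset.sum_congr rfl fun r _ => ?_
      rw [hprod]
      rcases Nat.eq_zero_or_pos (r j) with h0 | h0
      · simp only [hA, hB', h0, if_true, slashCoeff_succ_zero c D (hk j) (l j) hJ0, hG]
        ring
      · obtain ⟨q, hq⟩ := Nat.exists_eq_succ_of_ne_zero h0.ne'
        simp only [hA, hB', hq, slashCoeff_succ_succ c D (hk j) (l j) q hJ0, hG,
          Nat.succ_ne_zero, if_false, Nat.succ_sub_one]
        ring
  exact hind _ l rfl

/-- The shift `2n` of the weight accounts for the factor `det^n` that the derivatives produce in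
`sum_bracketCoeff_mul`. -/
theorem halfPow_add_two_smul {a : F} (ha : ∀ i, 0 < σ i a) (k₁ k₂ n : Fin d → ℕ) :
    (halfPow σ a (k₁ + k₂ + 2 • n) : ℂ) =
      halfPow σ a k₁ * halfPow σ a k₂ * ∏ i, ((σ i a : ℝ) : ℂ) ^ n i := by
  rw [← Complex.ofReal_mul]
  simp only [← Complex.ofReal_pow, ← Complex.ofReal_prod, ← Complex.ofReal_mul]
  congr 1
  simp only [halfPow, ← Finset.prod_mul_distrib]
  refine Finset.prod_congr rfl fun i _ => ?_
  rw [← Real.rpow_natCast, ← Real.rpow_add (ha i), ← Real.rpow_add (ha i)]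
  congr 1
  simp only [Pi.add_apply, Pi.smul_apply, smul_eq_mul]
  push_cast
  ring

/-- The summand is a product over the variables and the range is a box, so the sum is the product of
the sums in `sum_slashCoeff_mul`. -/
theorem sum_bracketCoeff_mul (γ : GL (Fin 2) F) {k₁ k₂ : Fin d → ℕ} (hk₁ : ∀ i, 0 < k₁ i)
    (hk₂ : ∀ i, 0 < k₂ i) (n : Fin d → ℕ) {r s : Fin d → ℕ} (hr : r ≤ n) (hs : s ≤ n)
    (z : Fin d → ℂ) :
    ∑ l ∈ Finset.Icc 0 n, bracketCoeff k₁ k₂ n l * slashCoeffProd σ γ Finset.univ k₁ l r z *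
      slashCoeffProd σ γ Finset.univ k₂ (n - l) s z =
    if s = n - r then bracketCoeff k₁ k₂ n r * (∏ i, ((σ i γ.val.det : ℝ) : ℂ) ^ n i) *
      (∏ i, denom σ γ i (z i) ^ (k₁ + k₂ + 2 • n) i)⁻¹ else 0 := by
  have h1 := fun i => sum_slashCoeff_mul (σ i (γ 1 0) : ℝ) (σ i γ.val.det : ℝ) (hk₁ i) (hk₂ i)
    (n i) (r i) (s i) (hr i) (hs i) (denom σ γ i (z i))
  have h2 := Finset.prod_congr (rfl : (Finset.univ : Finset (Fin d)) = Finset.univ)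
    fun i _ => h1 i
  rw [Finset.prod_univ_sum] at h2
  have h3 : Fintype.piFinset (fun i => Finset.Icc 0 (n i)) = Finset.Icc 0 n := rfl
  rw [h3] at h2
  refine (Finset.sum_congr rfl fun l _ => ?_).trans (h2.trans ?_)
  · simp only [bracketCoeff, slashCoeffProd, ← Finset.prod_pow_eq_pow_sum,
      ← Finset.prod_mul_distrib, Pi.sub_apply]
  · split_ifs with h
    · subst h
      simp only [Pi.sub_apply, if_true, bracketCoeff, ← Finset.prod_pow_eq_pow_sum,
        Finset.prod_mul_distrib, Finset.prod_inv_distrib, Pi.add_apply, Pi.smul_apply, smul_eq_mul]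
    · obtain ⟨i, hi⟩ := Function.ne_iff.1 h
      exact Finset.prod_eq_zero (Finset.mem_univ i) (if_neg hi)

/-- The Rankin-Cohen bracket commutes with the slash operators. -/
theorem rankinCohen_slash {γ : GL (Fin 2) F} (hγ : PosDet σ γ) {k₁ k₂ : Fin d → ℕ}
    (hk₁ : ∀ i, 0 < k₁ i) (hk₂ : ∀ i, 0 < k₂ i) (n : Fin d → ℕ) {f g : (Fin d → ℂ) → ℂ}
    (hf : DifferentiableOn ℂ f (upperHalf d)) (hg : DifferentiableOn ℂ g (upperHalf d)) :
    EqOn (rankinCohen k₁ k₂ n (slash σ k₁ γ f) (slash σ k₂ γ g))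
      (slash σ (k₁ + k₂ + 2 • n) γ (rankinCohen k₁ k₂ n f g)) (upperHalf d) := by
  intro z hz
  rw [slash_apply, halfPow_add_two_smul hγ, rankinCohen, rankinCohen]
  -- Enlarging the inner ranges by zero terms makes them independent of `l`, so that the sum over
  -- `l` can be taken first.
  have hext : ∀ (k : Fin d → ℕ) (l : Fin d → ℕ) (G : (Fin d → ℕ) → ℂ), l ≤ n →
      ∑ r ∈ Finset.Icc 0 l, slashCoeffProd σ γ Finset.univ k l r z * G r =
      ∑ r ∈ Finset.Icc 0 n, slashCoeffProd σ γ Finset.univ k l r z * G r := by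
    intro k l G hl
    refine Finset.sum_subset (Finset.Icc_subset_Icc_right hl) fun r _ hr => ?_
    rw [Finset.mem_Icc, not_and] at hr
    rw [slashCoeffProd_of_not_le (hr (zero_le)), zero_mul]
  set f' := fun r => mixedDeriv r f (moebius σ γ z)
  set g' := fun r => mixedDeriv r g (moebius σ γ z)
  have hterm : ∀ l ∈ Finset.Icc 0 n, bracketCoeff k₁ k₂ n l *
      mixedDeriv l (slash σ k₁ γ f) z * mixedDeriv (n - l) (slash σ k₂ γ g) z =
      (halfPow σ γ.val.det k₁ * halfPow σ γ.val.det k₂ : ℂ) *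
      ∑ r ∈ Finset.Icc 0 n, ∑ s ∈ Finset.Icc 0 n, bracketCoeff k₁ k₂ n l *
        slashCoeffProd σ γ Finset.univ k₁ l r z *
        slashCoeffProd σ γ Finset.univ k₂ (n - l) s z * (f' r * g' s) := by
    intro l hl
    rw [mixedDeriv_slash hγ hk₁ hf l hz, mixedDeriv_slash hγ hk₂ hg (n - l) hz]
    simp only
    rw [hext k₁ l f' (Finset.mem_Icc.1 hl).2, hext k₂ (n - l) g' tsub_le_self]
    have : ∀ a b c x y : ℂ, a * (b * x) * (c * y) = b * c * (a * (x * y)) := by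
      intros; ring
    rw [this, Finset.sum_mul_sum]
    simp only [Finset.mul_sum]
    refine Finset.sum_congr rfl fun r _ => Finset.sum_congr rfl fun s _ => ?_
    ring
  rw [Finset.sum_congr rfl hterm, ← Finset.mul_sum, Finset.sum_comm]
  have hswap : ∀ r ∈ Finset.Icc 0 n, (∑ l ∈ Finset.Icc 0 n, ∑ s ∈ Finset.Icc 0 n,
      bracketCoeff k₁ k₂ n l * slashCoeffProd σ γ Finset.univ k₁ l r z *
        slashCoeffProd σ γ Finset.univ k₂ (n - l) s z * (f' r * g' s)) =
      bracketCoeff k₁ k₂ n r * (∏ i, ((σ i γ.val.det : ℝ) : ℂ) ^ n i) *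
      (∏ i, denom σ γ i (z i) ^ (k₁ + k₂ + 2 • n) i)⁻¹ * (f' r * g' (n - r)) := by
    intro r hr
    rw [Finset.sum_comm]
    simp only [← Finset.sum_mul]
    rw [Finset.sum_congr rfl fun s hs => by
      rw [sum_bracketCoeff_mul γ hk₁ hk₂ n (Finset.mem_Icc.1 hr).2 (Finset.mem_Icc.1 hs).2 z]]
    simp only [ite_mul, zero_mul]
    rw [Finset.sum_ite_eq' (Finset.Icc 0 n) (n - r)]
    rw [if_pos (Finset.mem_Icc.2 ⟨zero_le, tsub_le_self⟩)]
  rw [Finset.sum_congr rfl hswap]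
  simp only [Finset.mul_sum]
  refine Finset.sum_congr rfl fun r _ => ?_
  simp only [f', g']
  ring

end Equivariance

/-! ### Summation over algebraic integers, and units modulo squares. -/

section Lattice

theorem summable_prod_pi {d : ℕ} {w : ℤ → ℝ} (hw0 : ∀ m, 0 ≤ w m) (hw : Summable w) :
    Summable fun m : Fin d → ℤ => ∏ i, w (m i) := by
  induction d with
  | zero => exact (hasSum_fintype _).summable
  | succ d ih =>
    rw [← (Fin.consEquiv fun _ : Fin (d + 1) => ℤ).summable_iff]
    refine (hw.mul_of_nonneg ih hw0 fun m => Finset.prod_nonneg fun i _ => hw0 _).congr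
      fun p => ?_
    simp [Fin.prod_univ_succ, Fin.consEquiv]

/-- The factor `1/2` anticipates rounding: `1 + |x| ≥ (1 + |⌊x⌋|) / 2` for real `x`. -/
theorem summable_int_weight :
    Summable fun m : ℤ => ((1 + |(m : ℝ)|) / 2) ^ (-(3 / 2) : ℝ) := by
  have h := (Real.summable_abs_int_rpow (b := 3 / 2) (by norm_num)).mul_left
    ((1 / 2 : ℝ) ^ (-(3 / 2) : ℝ))
  refine h.of_norm_bounded_eventually ?_
  rw [Filter.eventually_cofinite]
  -- At `m = 0` the comparison fails, since there the real power in the majorant is `0` by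
  -- convention.
  refine (Set.finite_singleton (0 : ℤ)).subset fun m hm => ?_
  by_contra hm0
  refine hm ?_
  have hm1 : 0 < |(m : ℝ)| := abs_pos.2 (Int.cast_ne_zero.2 hm0)
  rw [Real.norm_of_nonneg (by positivity), ← Real.mul_rpow (by norm_num) hm1.le]
  exact Real.rpow_le_rpow_of_nonpos (by positivity) (by linarith) (by norm_num)

variable {F : Type*} [Field F] [NumberField F] {d : ℕ} (σ : Fin d ≃ (F →+* ℝ))

theorem eq_zero_of_abs_conj_lt_one [NumberField.IsTotallyReal F] {x : 𝓞 F}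
    (h : ∀ i, |σ i (x : F)| < 1) : x = 0 := by
  by_contra hx
  have hw : ∀ w : NumberField.InfinitePlace F, w (x : F) < 1 := fun w => by
    have hr := NumberField.IsTotallyReal.isReal w
    rw [← NumberField.InfinitePlace.norm_embedding_of_isReal hr]
    simpa using h (σ.symm (NumberField.InfinitePlace.embedding_of_isReal hr))
  obtain ⟨w⟩ : Nonempty (NumberField.InfinitePlace F) := inferInstance
  exact absurd (NumberField.InfinitePlace.one_le_of_lt_one hx fun z _ => hw z) (not_le.2 (hw w))

/-- The weight `∏ (1 + |x_i|)^{-3/2}`. -/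
noncomputable def latticeWeight (x : F) : ℝ := ∏ i, (1 + |σ i x|) ^ (-(3 / 2) : ℝ)

theorem latticeWeight_nonneg (x : F) : 0 ≤ latticeWeight σ x :=
  Finset.prod_nonneg fun i _ => by positivity

/-- Taking floors of all conjugates embeds `𝓞` into `ℤ^d`: integers with equal floors differ by an
integer with all conjugates below `1` in absolute value, which is `0`. No integral basis is needed.
-/
theorem summable_latticeWeight [NumberField.IsTotallyReal F] :
    Summable fun x : 𝓞 F => latticeWeight σ (x : F) := by
  have hinj : Function.Injective fun (x : 𝓞 F) (i : Fin d) => ⌊σ i (x : F)⌋ := by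
    intro x y hxy
    refine sub_eq_zero.1 (eq_zero_of_abs_conj_lt_one σ fun i => ?_)
    have := Int.abs_sub_lt_one_of_floor_eq_floor (congrFun hxy i)
    simpa using this
  refine Summable.of_nonneg_of_le (fun x => latticeWeight_nonneg σ _) (fun x => ?_)
    ((summable_prod_pi (fun m => by positivity) summable_int_weight).comp_injective hinj)
  refine Finset.prod_le_prod (fun i _ => by positivity) fun i _ => ?_
  refine Real.rpow_le_rpow_of_nonpos (by positivity) ?_ (by norm_num)
  have h1 := Int.floor_le (σ i (x : F))
  have h2 := Int.lt_floor_add_one (σ i (x : F))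
  have h3 : |(⌊σ i (x : F)⌋ : ℝ)| ≤ |σ i (x : F)| + 1 := by
    rw [abs_le]
    constructor
    · linarith [neg_abs_le (σ i (x : F))]
    · linarith [le_abs_self (σ i (x : F))]
  linarith [abs_nonneg (σ i (x : F))]

/-- The unit group is finitely generated, so the squares have finite index. -/
theorem exists_finset_units_sq :
    ∃ R : Finset (𝓞 F)ˣ, ∀ u : (𝓞 F)ˣ, ∃ η : (𝓞 F)ˣ, η ^ 2 * u ∈ R := by
  classical
  have hfg : Group.FG (𝓞 F)ˣ := Group.fg_iff_monoid_fg.2 inferInstance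
  have hfin := Subgroup.finiteIndex_range_powMonoidHom_of_fg (𝓞 F)ˣ (n := 2) (by norm_num)
  have : Finite ((𝓞 F)ˣ ⧸ (powMonoidHom (α := (𝓞 F)ˣ) 2).range) := inferInstance
  have := Fintype.ofFinite ((𝓞 F)ˣ ⧸ (powMonoidHom (α := (𝓞 F)ˣ) 2).range)
  refine ⟨Finset.univ.image fun q : (𝓞 F)ˣ ⧸ (powMonoidHom (α := (𝓞 F)ˣ) 2).range => q.out,
    fun u => ?_⟩
  obtain ⟨⟨_, η, rfl⟩, hη⟩ := QuotientGroup.mk_out_eq_mul (powMonoidHom (α := (𝓞 F)ˣ) 2).range u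
  exact ⟨η, Finset.mem_image.2 ⟨_, Finset.mem_univ _, hη.trans (mul_comm _ _)⟩⟩

end Lattice

/-! ### Bounds for slashed exponentials. -/

section Bound

/-- For small `s` only the power counts and `k ≥ 3` suffices; for large `s` the Gaussian absorbs
`s^k`. The constant serves all `b ≥ a`, hence all points of a neighbourhood. -/
theorem exists_pow_mul_exp_le {a : ℝ} (ha : 0 < a) {k : ℕ} (hk : 3 ≤ k) :
    ∃ C : ℝ, 0 ≤ C ∧ ∀ b s : ℝ, a ≤ b → 0 ≤ s →
      s ^ k * Real.exp (-b * s ^ 2) ≤ C * (s / (1 + s)) ^ 3 := by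
  refine ⟨k.factorial * Real.exp (1 + 1 / (4 * a)), by positivity, fun b s hb hs => ?_⟩
  have h1 : (1 + s) ^ k ≤ k.factorial * Real.exp (1 + s) := by
    have := Real.pow_div_factorial_le_exp (1 + s) (by positivity) k
    rwa [div_le_iff₀ (by positivity), mul_comm] at this
  have h2 : Real.exp (1 + s) * Real.exp (-b * s ^ 2) ≤ Real.exp (1 + 1 / (4 * a)) := by
    rw [← Real.exp_add, Real.exp_le_exp]
    -- Completing the square gives `s ≤ a s² + 1/(4a)`, the source of the constant.
    have h3 : 1 / (4 * a) + a * s ^ 2 - s = (2 * a * s - 1) ^ 2 / (4 * a) := by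
      field_simp
      ring
    have h4 : 0 ≤ (2 * a * s - 1) ^ 2 / (4 * a) := by positivity
    nlinarith [sq_nonneg s, mul_le_mul_of_nonneg_right hb (sq_nonneg s)]
  have h5 : s ^ k ≤ (s / (1 + s)) ^ 3 * (1 + s) ^ k := by
    obtain ⟨m, rfl⟩ := Nat.exists_eq_add_of_le hk
    rw [pow_add, pow_add (1 + s), ← mul_assoc, ← mul_pow, div_mul_cancel₀ _ (by positivity)]
    gcongr
    linarith
  calc s ^ k * Real.exp (-b * s ^ 2)
      ≤ (s / (1 + s)) ^ 3 * (k.factorial * Real.exp (1 + s)) * Real.exp (-b * s ^ 2) := by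
        gcongr
        exact h5.trans (by gcongr)
    _ = k.factorial * (Real.exp (1 + s) * Real.exp (-b * s ^ 2)) * (s / (1 + s)) ^ 3 := by ring
    _ ≤ _ := by gcongr

theorem abs_add_abs_le_mul_norm {c e y₀ T : ℝ} (hy₀ : 0 < y₀) {w : ℂ} (hw : y₀ ≤ w.im)
    (hT : ‖w‖ ≤ T) : |c| + |e| ≤ (1 + (1 + T) / y₀) * ‖(c : ℂ) * w + e‖ := by
  have h1 : |c| * y₀ ≤ ‖(c : ℂ) * w + e‖ := by
    have := Complex.abs_im_le_norm ((c : ℂ) * w + e)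
    simp only [Complex.add_im, Complex.mul_im, Complex.ofReal_re, Complex.ofReal_im, zero_mul,
      add_zero, abs_mul] at this
    refine le_trans ?_ this
    gcongr
    exact hw.trans (le_abs_self _)
  have h2 : |e| ≤ ‖(c : ℂ) * w + e‖ + |c| * T := by
    have h := norm_sub_le ((c : ℂ) * w + e) ((c : ℂ) * w)
    rw [add_sub_cancel_left, norm_mul, Complex.norm_real, Complex.norm_real, Real.norm_eq_abs,
      Real.norm_eq_abs] at h
    exact h.trans (by gcongr)
  have hT0 : 0 ≤ T := (norm_nonneg _).trans hT
  have h3 : |c| ≤ ‖(c : ℂ) * w + e‖ / y₀ := by rwa [le_div_iff₀ hy₀]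
  calc |c| + |e| ≤ |c| * (1 + T) + ‖(c : ℂ) * w + e‖ := by linarith
    _ ≤ ‖(c : ℂ) * w + e‖ / y₀ * (1 + T) + ‖(c : ℂ) * w + e‖ := by gcongr
    _ = _ := by ring

/-- One factor of `norm_slash_expTr`. With `s = ρ / |cw+e|` one has `s / (1+s) = ρ / (|cw+e| + ρ)`,
which stays bounded when `cw+e` is small and otherwise decays like `1 / (|c| + |e|)`. The parameter
`B` leaves room for clearing the denominators of `c`. -/
theorem exists_factor_bound {a y₀ T ρ₁ B : ℝ} (ha : 0 < a) (hy₀ : 0 < y₀)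
    {k : ℕ} (hk : 3 ≤ k) : ∃ C : ℝ, 0 ≤ C ∧ ∀ (w : ℂ) (c e ρ : ℝ), y₀ ≤ w.im → ‖w‖ ≤ T →
      0 ≤ ρ → ρ ≤ ρ₁ → (c : ℂ) * w + e ≠ 0 →
      (ρ / ‖(c : ℂ) * w + e‖) ^ k * Real.exp (-(a * w.im) * (ρ / ‖(c : ℂ) * w + e‖) ^ 2) ≤
        C * ((1 + |B * c|) ^ (-(3 / 2) : ℝ) * (1 + |e|) ^ (-(3 / 2) : ℝ)) := by
  obtain ⟨C, hC0, hC⟩ := exists_pow_mul_exp_le (mul_pos ha hy₀) hk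
  set L : ℝ := 1 + |(1 + T) / y₀| with hL
  set A : ℝ := (1 + |ρ₁|) * L * (1 + |B|) with hA
  refine ⟨C * A ^ 3, by positivity, fun w c e ρ hw hT hρ hρ₁ hne => ?_⟩
  set J : ℝ := ‖(c : ℂ) * w + e‖ with hJ
  have hJ0 : 0 < J := norm_pos_iff.2 hne
  have h1 := hC (a * w.im) (ρ / J) (by gcongr) (by positivity)
  have h2 : |c| + |e| ≤ L * J := by
    refine (abs_add_abs_le_mul_norm hy₀ hw hT).trans ?_
    rw [hL]
    gcongr
    exact le_abs_self _
  have hX : 0 < 1 + |B * c| + |e| := by positivity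
  have h3 : ρ / J / (1 + ρ / J) ≤ A / (1 + |B * c| + |e|) := by
    have e1 : ρ / J / (1 + ρ / J) = ρ / (J + ρ) := by field_simp
    rw [e1, div_le_div_iff₀ (by positivity) hX]
    have e2 : 1 + |B * c| + |e| ≤ (1 + |B|) * (1 + (|c| + |e|)) := by
      rw [abs_mul]
      nlinarith [abs_nonneg B, abs_nonneg c, abs_nonneg e, mul_nonneg (abs_nonneg B) (abs_nonneg e)]
    have e3 : ρ * (1 + (|c| + |e|)) ≤ (1 + |ρ₁|) * L * (J + ρ) := by
      have e4 : ρ ≤ 1 + |ρ₁| := hρ₁.trans ((le_abs_self _).trans (by linarith))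
      have e5 : 1 ≤ L := by rw [hL]; linarith [abs_nonneg ((1 + T) / y₀)]
      calc ρ * (1 + (|c| + |e|)) ≤ ρ * (1 + L * J) := by gcongr
        _ = ρ + ρ * (L * J) := by ring
        _ ≤ (1 + |ρ₁|) * L * ρ + (1 + |ρ₁|) * (L * J) := by
          refine add_le_add ?_ (by gcongr)
          have : 1 ≤ (1 + |ρ₁|) * L :=
            one_le_mul_of_one_le_of_one_le (by linarith [abs_nonneg ρ₁]) e5
          nlinarith
        _ = _ := by ring
    calc ρ * (1 + |B * c| + |e|) ≤ ρ * ((1 + |B|) * (1 + (|c| + |e|))) := by gcongr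
      _ = (1 + |B|) * (ρ * (1 + (|c| + |e|))) := by ring
      _ ≤ (1 + |B|) * ((1 + |ρ₁|) * L * (J + ρ)) := by gcongr
      _ = _ := by rw [hA]; ring
  -- The exponent `3` is split evenly through `(1 + X + Y)² ≥ (1 + X)(1 + Y)`; each half `3/2`
  -- exceeds `1`, as summability requires.
  have h4 : ((1 + |B * c| + |e|)⁻¹) ^ 3 ≤
      (1 + |B * c|) ^ (-(3 / 2) : ℝ) * (1 + |e|) ^ (-(3 / 2) : ℝ) := by
    rw [← Real.mul_rpow (by positivity) (by positivity)]
    have e1 : ((1 + |B * c| + |e|)⁻¹) ^ 3 = ((1 + |B * c| + |e|) ^ 2) ^ (-(3 / 2) : ℝ) := by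
      rw [← Real.rpow_natCast _ 2, ← Real.rpow_mul hX.le, inv_pow, ← Real.rpow_natCast _ 3,
        ← Real.rpow_neg hX.le]
      norm_num
    rw [e1]
    refine Real.rpow_le_rpow_of_nonpos (by positivity) ?_ (by norm_num)
    nlinarith [abs_nonneg (B * c), abs_nonneg e, mul_nonneg (abs_nonneg (B * c)) (abs_nonneg e)]
  calc _ ≤ C * (ρ / J / (1 + ρ / J)) ^ 3 := h1
    _ ≤ C * (A / (1 + |B * c| + |e|)) ^ 3 := by gcongr
    _ = C * A ^ 3 * ((1 + |B * c| + |e|)⁻¹) ^ 3 := by rw [div_eq_mul_inv, mul_pow]; ring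
    _ ≤ _ := by gcongr

variable {F : Type*} [Field F] {d : ℕ} {σ : Fin d ≃ (F →+* ℝ)}

theorem norm_expTr (μ : F) (z : Fin d → ℂ) :
    ‖expTr σ μ z‖ = ∏ i, Real.exp (-(2 * Real.pi * σ i μ * (z i).im)) := by
  rw [expTr, Complex.norm_exp, ← Real.exp_sum]
  congr 1
  rw [show (2 * Real.pi * Complex.I * ∑ i, ((σ i μ : ℝ) : ℂ) * z i : ℂ) =
    Complex.I * ((2 * Real.pi : ℝ) * ∑ i, ((σ i μ : ℝ) : ℂ) * z i) by push_cast; ring,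
    Complex.I_mul_re, Complex.im_ofReal_mul, Complex.im_sum, Finset.mul_sum, ← Finset.sum_neg_distrib]
  refine Finset.sum_congr rfl fun i _ => ?_
  rw [Complex.im_ofReal_mul]
  ring

/-- Since `Im γz = det · Im z / |cz+e|²`, the automorphy factor and the exponential both depend on
`γ` only through `√det / |cz+e|`. -/
theorem norm_slash_expTr {γ : GL (Fin 2) F} (hγ : PosDet σ γ) (k : Fin d → ℕ) (μ : F)
    (z : Fin d → ℂ) : ‖slash σ k γ (expTr σ μ) z‖ =
    ∏ i, (√(σ i γ.val.det) / ‖denom σ γ i (z i)‖) ^ k i *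
      Real.exp (-(2 * Real.pi * σ i μ * (z i).im) *
        (√(σ i γ.val.det) / ‖denom σ γ i (z i)‖) ^ 2) := by
  have h0 : 0 ≤ halfPow σ γ.val.det k := Finset.prod_nonneg fun i _ => by
    exact Real.rpow_nonneg (hγ i).le _
  rw [slash_apply, norm_mul, norm_mul, norm_expTr, norm_inv, norm_prod, Complex.norm_real,
    Real.norm_of_nonneg h0, halfPow, ← Finset.prod_inv_distrib, ← Finset.prod_mul_distrib,
    ← Finset.prod_mul_distrib]
  refine Finset.prod_congr rfl fun i _ => ?_
  rw [moebius_im, Complex.normSq_eq_norm_sq, div_pow, div_pow, Real.sq_sqrt (hγ i).le, norm_pow]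
  congr 1
  · rw [Real.sqrt_eq_rpow, ← Real.rpow_natCast (_ ^ (1 / 2 : ℝ)), ← Real.rpow_mul (hγ i).le,
      div_eq_mul_inv]
    congr 2
    ring
  · congr 1
    ring

end Bound

/-! ### The group `Γ` and the majorant for the sum over `(ZN) \ Γ`. -/

section Gamma

variable {F : Type*} [Field F] [NumberField F] {d : ℕ} {σ : Fin d ≃ (F →+* ℝ)}
  {𝔠 : FractionalIdeal (𝓞 F)⁰ F} {𝔫 : Ideal (𝓞 F)}

theorem posDet_of_mem {γ : GL (Fin 2) F} (hγ : γ ∈ Gamma0 𝔠 𝔫) : PosDet σ γ := fun i => by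
  obtain ⟨-, -, -, -, u, hu, hdet⟩ := hγ
  rw [hdet]
  exact hu (σ i)

theorem matU_val (ε : (𝓞 F)ˣ) : (matU ε).val = !![((ε : 𝓞 F) : F), 0; 0, 1] := rfl

theorem matZ_val (η : (𝓞 F)ˣ) : (matZ η).val =
    !![((η : 𝓞 F) : F), 0; 0, ((η : 𝓞 F) : F)] := rfl

theorem matN_val (b : F) : (matN b).val = !![1, b; 0, 1] := rfl

theorem matU_one : (matU 1 : GL (Fin 2) F) = 1 := by
  apply Units.ext
  simp [matU_val, Matrix.one_fin_two]

theorem matZ_one : (matZ 1 : GL (Fin 2) F) = 1 := by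
  apply Units.ext
  simp [matZ_val, Matrix.one_fin_two]

theorem matN_zero : (matN 0 : GL (Fin 2) F) = 1 := by
  apply Units.ext
  simp [matN_val, Matrix.one_fin_two]

theorem matU_mul_matZ_mul_matN_mem {ε : (𝓞 F)ˣ} (hε : ε ∈ totPosUnits F) (η : (𝓞 F)ˣ) {b : F}
    (hb : b ∈ (𝔠 * different F)⁻¹) : matU ε * matZ η * matN b ∈ GammaInf 𝔠 :=
  ⟨ε, hε, η, b, hb, rfl⟩

theorem matU_mem_gammaInf {ε : (𝓞 F)ˣ} (hε : ε ∈ totPosUnits F) : matU ε ∈ GammaInf 𝔠 := by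
  simpa [matZ_one, matN_zero] using
    matU_mul_matZ_mul_matN_mem (𝔠 := 𝔠) hε 1 (FractionalIdeal.zero_mem _)

theorem matZ_mul_matN_mem_gammaInf (η : (𝓞 F)ˣ) {b : F} (hb : b ∈ (𝔠 * different F)⁻¹) :
    matZ η * matN b ∈ GammaInf 𝔠 := by
  simpa [matU_one] using matU_mul_matZ_mul_matN_mem (𝔠 := 𝔠) (one_mem _) η hb

theorem gammaInf_le : GammaInf 𝔠 ≤ Gamma0 𝔠 𝔫 := by
  rintro _ ⟨ε, hε, η, b, hb, rfl⟩
  have hη : ∀ u : (𝓞 F)ˣ, ((u : 𝓞 F) : F) ∈ (1 : FractionalIdeal (𝓞 F)⁰ F) := fun u =>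
    FractionalIdeal.coe_mem_one _ _
  refine ⟨?_, ?_, ?_, ?_, ε * η ^ 2, mul_mem hε fun τ => ?_, ?_⟩
  · rw [matUZN_val]
    exact one_mul_mem _ (hη ε) (hη η)
  · rw [matUZN_val]
    exact hη η
  · rw [matUZN_val]
    exact one_mul_mem _ (one_mul_mem _ (hη ε) (hη η)) hb
  · rw [matUZN_val]
    exact FractionalIdeal.zero_mem _
  · have : τ ((η : 𝓞 F) : F) ≠ 0 := by simp
    simpa using pow_pos (sq_pos_of_ne_zero this) 1
  · rw [matUZN_val, Matrix.det_fin_two]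
    simp
    ring

theorem matU_mem {ε : (𝓞 F)ˣ} (hε : ε ∈ totPosUnits F) : matU ε ∈ Gamma0 𝔠 𝔫 :=
  gammaInf_le (matU_mem_gammaInf hε)

/-- Two elements of `Γ` whose bottom rows differ by a unit `ω`, and whose determinants differ
by `ω²`, differ by a scalar and a translation. -/
theorem eq_matZ_mul_matN_mul {γ δ : GL (Fin 2) F} (hγ : γ ∈ Gamma0 𝔠 𝔫) (hδ : δ ∈ Gamma0 𝔠 𝔫)
    (ω : (𝓞 F)ˣ) (h0 : γ 1 0 = ((ω : 𝓞 F) : F) * δ 1 0) (h1 : γ 1 1 = ((ω : 𝓞 F) : F) * δ 1 1)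
    (hdet : γ.val.det = ((ω : 𝓞 F) : F) ^ 2 * δ.val.det) :
    ∃ b ∈ (𝔠 * different F)⁻¹, γ = matZ ω * matN b * δ := by
  obtain ⟨ν, rfl⟩ : ∃ ν, γ = ν * δ := ⟨γ * δ⁻¹, by simp⟩
  have hν : ν ∈ Gamma0 𝔠 𝔫 := by
    simpa using mul_mem hγ (inv_mem hδ)
  have hω : ((ω : 𝓞 F) : F) ≠ 0 := by simp
  have hD : δ.val.det ≠ 0 := (Matrix.isUnits_det_units δ).ne_zero
  rw [Units.val_mul, Matrix.det_mul] at hdet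
  have hνdet := mul_right_cancel₀ hD hdet
  simp only [Units.val_mul, Matrix.mul_apply, Fin.sum_univ_two] at h0 h1
  rw [Matrix.det_fin_two] at hD hνdet
  have e10 : ν 1 0 = 0 := by
    have : ν 1 0 * (δ 0 0 * δ 1 1 - δ 0 1 * δ 1 0) = 0 := by
      linear_combination δ 1 1 * h0 - δ 1 0 * h1
    exact (mul_eq_zero.1 this).resolve_right hD
  have e11 : ν 1 1 = ((ω : 𝓞 F) : F) := by
    have : (ν 1 1 - ((ω : 𝓞 F) : F)) * (δ 0 0 * δ 1 1 - δ 0 1 * δ 1 0) = 0 := by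
      linear_combination δ 0 0 * h1 - δ 0 1 * h0
    exact sub_eq_zero.1 ((mul_eq_zero.1 this).resolve_right hD)
  have e00 : ν 0 0 = ((ω : 𝓞 F) : F) := by
    rw [e10, e11] at hνdet
    refine mul_right_cancel₀ hω ?_
    linear_combination hνdet
  refine ⟨(((ω⁻¹ : (𝓞 F)ˣ) : 𝓞 F) : F) * ν 0 1, unit_smul_mem _ _ hν.2.2.1, ?_⟩
  congr 1
  apply Units.ext
  have h := matUZN_val 1 ω ((((ω⁻¹ : (𝓞 F)ˣ) : 𝓞 F) : F) * ν 0 1)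
  rw [matU_one, one_mul] at h
  rw [h]
  ext i j
  fin_cases i <;> fin_cases j
  · simpa using e00
  · simp
  · simpa using e10
  · simpa using e11

theorem exists_integer_multiple (I : FractionalIdeal (𝓞 F)⁰ F) :
    ∃ D : F, D ≠ 0 ∧ ∀ x ∈ I, ∃ y : 𝓞 F, (y : F) = D * x := by
  obtain ⟨a, ha, h⟩ := I.2
  refine ⟨(a : F), by simpa using nonZeroDivisors.ne_zero ha, fun x hx => ?_⟩
  obtain ⟨y, hy⟩ := h x hx
  exact ⟨y, hy.trans (Algebra.smul_def _ _)⟩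

theorem scaled_denom (γ : GL (Fin 2) F) (i : Fin d) (w : ℂ) (η : ℝ) :
    ((η * σ i (γ 1 0) : ℝ) : ℂ) * w + ((η * σ i (γ 1 1) : ℝ) : ℂ) = η * denom σ γ i w := by
  rw [denom]; push_cast; ring

/-- The family may be any one without repetition modulo scalars and translations, so the same bound
serves the unit sums of the seeds and the full Poincaré series. -/
theorem locSummable_slash_expTr [NumberField.IsTotallyReal F] {ι : Type*} {m : ι → GL (Fin 2) F}
    (hm : ∀ i, m i ∈ Gamma0 𝔠 𝔫)
    (hinj : ∀ i j (η : (𝓞 F)ˣ), ∀ b ∈ (𝔠 * different F)⁻¹, m i = matZ η * matN b * m j → i = j)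
    {k : Fin d → ℕ} (hk : ∀ i, 2 < k i) {μ : F} (hμ : IsTotallyPositive μ) :
    LocSummable fun i => slash σ k (m i) (expTr σ μ) := by
  intro z hz
  obtain ⟨R, hR⟩ := exists_finset_units_sq (F := F)
  obtain ⟨D, hD0, hD⟩ := exists_integer_multiple
    (𝔠 * (𝔫 : FractionalIdeal (𝓞 F)⁰ F) * different F)
  choose u hu hdet using fun i => (hm i).2.2.2.2
  choose η hη using fun i => hR (u i)
  choose x hx using fun i => hD _ (unit_smul_mem _ ((η i : (𝓞 F)ˣ) : 𝓞 F) (hm i).2.2.2.1)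
  have hy' : ∀ i, ∃ y : 𝓞 F, (y : F) = ((η i : 𝓞 F) : F) * m i 1 1 := fun i =>
    (FractionalIdeal.mem_one_iff _).1 (unit_smul_mem _ ((η i : (𝓞 F)ˣ) : 𝓞 F) (hm i).2.1)
  choose y hy using hy'
  have hηdet : ∀ i, (((η i ^ 2 * u i : (𝓞 F)ˣ) : 𝓞 F) : F) =
      ((η i : 𝓞 F) : F) ^ 2 * (m i).val.det := fun i => by
    rw [hdet]; simp
  have hη0 : ∀ i, ((η i : 𝓞 F) : F) ≠ 0 := fun i => by simp
  -- After multiplication by the scalar `η i`, the determinant lies in the finite set `R`, and the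
  -- bottom row, with `D` clearing the denominators of `c`, becomes a pair of integers. These data
  -- fix the matrix modulo `ZN`, so `ψ` is injective.
  set ψ : ι → R × 𝓞 F × 𝓞 F := fun i => (⟨η i ^ 2 * u i, hη i⟩, x i, y i) with hψ
  have hψinj : Function.Injective ψ := by
    intro i j hij
    simp only [hψ, Prod.mk.injEq, Subtype.mk.injEq] at hij
    obtain ⟨h1, h2, h3⟩ := hij
    have h1' := congrArg (fun v : (𝓞 F)ˣ => ((v : 𝓞 F) : F)) h1
    have h2' := congrArg (fun v : 𝓞 F => (v : F)) h2
    have h3' := congrArg (fun v : 𝓞 F => (v : F)) h3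
    simp only [hηdet, hx, hy] at h1' h2' h3'
    have h2'' := mul_left_cancel₀ hD0 h2'
    have hω : ((((η i)⁻¹ * η j : (𝓞 F)ˣ) : 𝓞 F) : F) =
        ((η i : 𝓞 F) : F)⁻¹ * ((η j : 𝓞 F) : F) := by
      simp
    obtain ⟨b, hb, hγ⟩ := eq_matZ_mul_matN_mul (hm i) (hm j) ((η i)⁻¹ * η j)
      (by rw [hω, mul_assoc, ← h2'', inv_mul_cancel_left₀ (hη0 i)])
      (by rw [hω, mul_assoc, ← h3', inv_mul_cancel_left₀ (hη0 i)])
      (by rw [hω, mul_pow, mul_assoc, ← h1', inv_pow, inv_mul_cancel_left₀ (pow_ne_zero 2 (hη0 i))])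
    exact hinj i j _ b hb hγ
  have hρ : ∀ j : Fin d, ∃ ρ₁ : ℝ, ∀ r ∈ R, √(σ j ((r : 𝓞 F) : F)) ≤ ρ₁ := fun j => by
    obtain ⟨M, hM⟩ := (R.image fun r : (𝓞 F)ˣ => √(σ j ((r : 𝓞 F) : F))).bddAbove
    exact ⟨M, fun r hr => hM (by simpa using ⟨r, hr, rfl⟩)⟩
  choose ρ₁ hρ₁ using hρ
  have hfac := fun j : Fin d => exists_factor_bound (a := 2 * Real.pi * σ j μ)
    (y₀ := (z j).im / 2) (T := ‖z j‖ + 1) (ρ₁ := ρ₁ j) (B := σ j D)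
    (mul_pos (by positivity) (hμ (σ j))) (half_pos (hz j)) (hk j)
  choose C hC0 hC using hfac
  refine ⟨fun i => (∏ j, C j) * (latticeWeight σ (x i : F) * latticeWeight σ (y i : F)), ?_, ?_⟩
  · have hW := summable_latticeWeight σ
    have h1 := hW.mul_of_nonneg hW (fun _ => latticeWeight_nonneg σ _)
      fun _ => latticeWeight_nonneg σ _
    have h2 := (summable_of_hasFiniteSupport (Set.toFinite _) :
      Summable fun _ : R => (1 : ℝ)).mul_of_nonneg h1 (fun _ => zero_le_one)
      fun _ => mul_nonneg (latticeWeight_nonneg σ _) (latticeWeight_nonneg σ _)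
    refine ((h2.comp_injective hψinj).mul_left (∏ j, C j)).congr fun i => ?_
    simp [hψ]
  · have hev : ∀ᶠ w in 𝓝 z, ∀ j, (z j).im / 2 < (w j).im ∧ ‖w j‖ < ‖z j‖ + 1 := by
      rw [Filter.eventually_all]
      intro j
      have hc : ContinuousAt (fun w : Fin d → ℂ => w j) z := (continuous_apply j).continuousAt
      exact ((Complex.continuous_im.continuousAt.comp hc).eventually
        (lt_mem_nhds (half_lt_self (hz j)))).and
        (hc.norm.eventually (gt_mem_nhds (lt_add_one _)))
    filter_upwards [hev] with w hw i
    have hwH : w ∈ upperHalf d := fun j => (half_pos (hz j)).trans (hw j).1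
    have hpos := posDet_of_mem (σ := σ) (hm i)
    rw [norm_slash_expTr hpos k μ w, latticeWeight, latticeWeight, ← Finset.prod_mul_distrib,
      ← Finset.prod_mul_distrib]
    refine Finset.prod_le_prod (fun j _ => by positivity) fun j _ => ?_
    have hηj : σ j ((η i : 𝓞 F) : F) ≠ 0 := by simp
    -- The quotient is unchanged under scalars, so the bound may be applied to the normalised
    -- matrix.
    have hs : √(σ j (m i).val.det) / ‖denom σ (m i) j (w j)‖ =
        √(σ j (((η i ^ 2 * u i : (𝓞 F)ˣ) : 𝓞 F) : F)) /
        ‖((σ j ((η i : 𝓞 F) : F) * σ j (m i 1 0) : ℝ) : ℂ) * w j +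
          ((σ j ((η i : 𝓞 F) : F) * σ j (m i 1 1) : ℝ) : ℂ)‖ := by
      rw [scaled_denom, norm_mul, Complex.norm_real, hηdet, map_mul,
        map_pow, Real.sqrt_mul (sq_nonneg _), Real.sqrt_sq_eq_abs, Real.norm_eq_abs,
        mul_div_mul_left _ _ (abs_ne_zero.2 hηj)]
    rw [hs]
    have hb := hC j (w j) (σ j ((η i : 𝓞 F) : F) * σ j (m i 1 0))
      (σ j ((η i : 𝓞 F) : F) * σ j (m i 1 1)) _ (hw j).1.le (hw j).2.le
      (Real.sqrt_nonneg (σ j (((η i ^ 2 * u i : (𝓞 F)ˣ) : 𝓞 F) : F))) (hρ₁ j _ (hη i)) (by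
        rw [scaled_denom]
        exact mul_ne_zero (Complex.ofReal_ne_zero.2 hηj) (denom_ne_zero hpos (hwH j)))
    rw [hx, hy, map_mul (σ j) D, map_mul, map_mul]
    exact hb

end Gamma

/-! ### Exponentials: derivatives, periodicity and behaviour under units. -/

section Exponential

variable {F : Type*} [Field F] {d : ℕ} {σ : Fin d ≃ (F →+* ℝ)}

theorem differentiable_expTr (μ : F) : Differentiable ℂ (expTr σ μ) := by
  unfold expTr
  fun_prop

theorem mixedDeriv_expTr (μ : F) (m : Fin d → ℕ) (z : Fin d → ℂ) :
    mixedDeriv m (expTr σ μ) z =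
      (∏ i, (2 * Real.pi * Complex.I * ((σ i μ : ℝ) : ℂ)) ^ m i) * expTr σ μ z := by
  have h1 : ∀ (i : Fin d) (c : ℂ), partialDeriv i (fun z => c * expTr σ μ z) =
      fun z => 2 * Real.pi * Complex.I * ((σ i μ : ℝ) : ℂ) * c * expTr σ μ z := by
    intro i c
    funext z
    have e1 : ∀ t, ∑ j, ((σ j μ : ℝ) : ℂ) * Function.update z i t j =
        ((σ i μ : ℝ) : ℂ) * t + ∑ j ∈ Finset.univ.erase i, ((σ j μ : ℝ) : ℂ) * z j := by
      intro t
      rw [← Finset.add_sum_erase _ _ (Finset.mem_univ i), Function.update_self]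
      congr 1
      refine Finset.sum_congr rfl fun j hj => ?_
      rw [Function.update_of_ne (Finset.ne_of_mem_erase hj)]
    have e2 := e1 (z i)
    rw [Function.update_eq_self] at e2
    simp only [partialDeriv, expTr, e1]
    have h2 : HasDerivAt (fun t => 2 * Real.pi * Complex.I * (((σ i μ : ℝ) : ℂ) * t +
        ∑ j ∈ Finset.univ.erase i, ((σ j μ : ℝ) : ℂ) * z j))
        (2 * Real.pi * Complex.I * ((σ i μ : ℝ) : ℂ)) (z i) := by
      simpa using (((hasDerivAt_id (z i)).const_mul ((σ i μ : ℝ) : ℂ)).add_const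
        (∑ j ∈ Finset.univ.erase i, ((σ j μ : ℝ) : ℂ) * z j)).const_mul
          (2 * Real.pi * Complex.I)
    rw [(h2.cexp.const_mul c).deriv, e2]
    ring
  have h2 : ∀ (i : Fin d) (r : ℕ) (c : ℂ), (partialDeriv i)^[r] (fun z => c * expTr σ μ z) =
      fun z => (2 * Real.pi * Complex.I * ((σ i μ : ℝ) : ℂ)) ^ r * c * expTr σ μ z := by
    intro i r c
    induction r with
    | zero => simp
    | succ r ih =>
      rw [Function.iterate_succ_apply', ih, h1]
      funext z
      ring
  have h3 : ∀ L : List (Fin d), L.foldr (fun i h => (partialDeriv i)^[m i] h) (expTr σ μ) =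
      fun z => (L.map fun i => (2 * Real.pi * Complex.I * ((σ i μ : ℝ) : ℂ)) ^ m i).prod *
        expTr σ μ z := by
    intro L
    induction L with
    | nil => simp
    | cons i L ih => rw [List.foldr_cons, ih, h2, List.map_cons, List.prod_cons]
  rw [mixedDeriv, h3, Fin.prod_univ_def]

theorem bracketSeed_eq (k₁ k₂ n : Fin d → ℕ) (μ : F) (f : (Fin d → ℂ) → ℂ) :
    bracketSeed σ k₁ k₂ n μ f = rankinCohen k₁ k₂ n f (expTr σ μ) := by
  funext z
  rw [bracketSeed, rankinCohen, Finset.mul_sum]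
  refine Finset.sum_congr rfl fun l _ => ?_
  rw [mixedDeriv_expTr]
  simp only [Pi.sub_apply]
  ring

variable [NumberField F]

theorem sum_conj_eq_trace [NumberField.IsTotallyReal F] (x : F) :
    ∑ i, ((σ i x : ℝ) : ℂ) = algebraMap ℚ ℂ (Algebra.trace ℚ F x) := by
  rw [trace_eq_sum_embeddings ℂ]
  let e : Fin d → (F →ₐ[ℚ] ℂ) := fun i => (Complex.ofRealHom.comp (σ i)).toRatAlgHom
  refine Function.Bijective.sum_comp (e := e) ⟨fun i j hij => ?_, fun τ => ?_⟩
    (fun τ : F →ₐ[ℚ] ℂ => τ x)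
  · refine σ.injective (RingHom.ext fun y => ?_)
    have := DFunLike.congr_fun hij y
    exact Complex.ofReal_injective this
  · have hτ := NumberField.IsTotallyReal.complexEmbedding_isReal (τ : F →+* ℂ)
    refine ⟨σ.symm hτ.embedding, AlgHom.ext fun y => ?_⟩
    simp only [e, Equiv.apply_symm_apply]
    exact NumberField.ComplexEmbedding.IsReal.coe_embedding_apply hτ y

/-- The product `μb` lies in the inverse different, which is the trace dual of `𝓞`. -/
theorem exists_int_sum_conj [NumberField.IsTotallyReal F] {𝔠 : FractionalIdeal (𝓞 F)⁰ F}
    (h𝔠 : 𝔠 ≠ 0) {μ b : F} (hμ : μ ∈ 𝔠) (hb : b ∈ (𝔠 * different F)⁻¹) :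
    ∃ N : ℤ, ∑ i, ((σ i (μ * b) : ℝ) : ℂ) = N := by
  have h1 := FractionalIdeal.mul_mem_mul hμ hb
  rw [mul_inv, mul_inv_cancel_left₀ h𝔠, different, coeIdeal_differentIdeal (K := ℚ), inv_inv] at h1
  obtain ⟨N, hN⟩ := (FractionalIdeal.mem_dual
    (one_ne_zero (α := FractionalIdeal (𝓞 F)⁰ F))).1 h1 1 (FractionalIdeal.one_mem_one _)
  rw [Algebra.traceForm_apply, mul_one] at hN
  refine ⟨N, ?_⟩
  rw [sum_conj_eq_trace, ← hN]
  simp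

theorem matZ_mul_matN_val (η : (𝓞 F)ˣ) (b : F) : (matZ η * matN b).val =
    !![((η : 𝓞 F) : F), ((η : 𝓞 F) : F) * b; 0, ((η : 𝓞 F) : F)] := by
  have h := matUZN_val 1 η b
  simpa [matU_one] using h

/-- The determinant `η²` contributes `|η|^k` against the automorphy factor `η^k`, leaving exactly
the sign product; the translation acts trivially because `Tr(μb)` is an integer. -/
theorem slash_matZ_mul_matN_expTr [NumberField.IsTotallyReal F] {𝔠 : FractionalIdeal (𝓞 F)⁰ F}
    (h𝔠 : 𝔠 ≠ 0) {μ b : F} (hμ : μ ∈ 𝔠) (hb : b ∈ (𝔠 * different F)⁻¹) {k : Fin d → ℕ}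
    {η : (𝓞 F)ˣ} (hη : ∏ i, Real.sign (σ i ((η : 𝓞 F) : F)) ^ k i = 1) (z : Fin d → ℂ) :
    slash σ k (matZ η * matN b) (expTr σ μ) z = expTr σ μ z := by
  have hη0 : ∀ i, σ i ((η : 𝓞 F) : F) ≠ 0 := fun i => by simp
  have hden : ∀ i, denom σ (matZ η * matN b) i (z i) = ((σ i ((η : 𝓞 F) : F) : ℝ) : ℂ) := by
    intro i
    rw [denom, matZ_mul_matN_val]
    simp
  have hmob : moebius σ (matZ η * matN b) z = fun i => z i + ((σ i b : ℝ) : ℂ) := by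
    funext i
    have := Complex.ofReal_ne_zero.2 (hη0 i)
    rw [moebius_apply, hden, matZ_mul_matN_val]
    simp only [Matrix.cons_val', Matrix.cons_val_zero, Matrix.cons_val_one, Matrix.of_apply,
      Matrix.cons_val_fin_one, map_mul, Complex.ofReal_mul]
    field_simp
  have hexp : expTr σ μ (fun i => z i + ((σ i b : ℝ) : ℂ)) = expTr σ μ z := by
    obtain ⟨N, hN⟩ := exists_int_sum_conj (σ := σ) h𝔠 hμ hb
    have hsum : ∑ i, ((σ i μ : ℝ) : ℂ) * (z i + ((σ i b : ℝ) : ℂ)) =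
        ∑ i, ((σ i μ : ℝ) : ℂ) * z i + N := by
      rw [← hN, ← Finset.sum_add_distrib]
      refine Finset.sum_congr rfl fun i _ => ?_
      rw [map_mul]; push_cast; ring
    rw [expTr, expTr, hsum, mul_add, Complex.exp_add, mul_comm (2 * (Real.pi : ℂ) * Complex.I) N,
      Complex.exp_int_mul_two_pi_mul_I, mul_one]
  have hpow : halfPow σ (matZ η * matN b).val.det k * (∏ i, σ i ((η : 𝓞 F) : F) ^ k i)⁻¹ = 1 := by
    rw [← hη, halfPow, ← Finset.prod_inv_distrib, ← Finset.prod_mul_distrib]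
    refine Finset.prod_congr rfl fun i _ => ?_
    have hdet : σ i (matZ η * matN b).val.det = |σ i ((η : 𝓞 F) : F)| ^ 2 := by
      rw [matZ_mul_matN_val, Matrix.det_fin_two, sq_abs]
      simp [sq]
    have habs := abs_pos.2 (hη0 i)
    rw [hdet, ← Real.rpow_natCast _ 2, ← Real.rpow_mul habs.le]
    rw [show ((2 : ℕ) : ℝ) * ((k i : ℝ) / 2) = k i by push_cast; ring, Real.rpow_natCast,
      ← inv_pow, ← mul_pow]
    congr 1
    rcases lt_or_gt_of_ne (hη0 i) with h | h
    · rw [abs_of_neg h, Real.sign_of_neg h, neg_mul, mul_inv_cancel₀ (hη0 i)]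
    · rw [abs_of_pos h, Real.sign_of_pos h, mul_inv_cancel₀ (hη0 i)]
  have hpow' := congrArg (fun t : ℝ => (t : ℂ)) hpow
  simp only [Complex.ofReal_mul, Complex.ofReal_inv, Complex.ofReal_prod, Complex.ofReal_pow,
    Complex.ofReal_one] at hpow'
  rw [slash_apply, hmob, hexp]
  simp only [hden]
  rw [hpow', one_mul]

theorem seedP_eq (k : Fin d → ℕ) (μ : F) : seedP σ k μ = unitSum σ k (expTr σ μ) ∧
    ∀ (ε : (𝓞 F)ˣ) (z : Fin d → ℂ), slash σ k (matU ε) (expTr σ μ) z =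
      (halfPow σ ((ε : 𝓞 F) : F) k : ℂ) * expTr σ (((ε : 𝓞 F) : F) * μ) z := by
  have h : ∀ (ε : (𝓞 F)ˣ) (z : Fin d → ℂ), slash σ k (matU ε) (expTr σ μ) z =
      (halfPow σ ((ε : 𝓞 F) : F) k : ℂ) * expTr σ (((ε : 𝓞 F) : F) * μ) z := by
    intro ε z
    have hden : ∀ i, denom σ (matU ε) i (z i) = 1 := by
      intro i
      rw [denom, matU_val]
      simp
    have hdet : (matU ε).val.det = ((ε : 𝓞 F) : F) := by
      rw [matU_val, Matrix.det_fin_two]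
      simp
    rw [slash_apply, hdet]
    simp only [hden, one_pow, Finset.prod_const_one, inv_one, mul_one]
    congr 1
    rw [expTr, expTr]
    congr 2
    refine Finset.sum_congr rfl fun i _ => ?_
    rw [moebius_apply, hden, matU_val]
    simp
    ring
  refine ⟨?_, h⟩
  funext z
  simp only [seedP, unitSum, h]

end Exponential

/-! ### Unfolding the Poincaré series and taking brackets termwise. -/

section Poincare

variable {F : Type*} [Field F] [NumberField F] {d : ℕ} {σ : Fin d ≃ (F →+* ℝ)}
  {𝔠 : FractionalIdeal (𝓞 F)⁰ F} {𝔫 : Ideal (𝓞 F)}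

/-- The matrices `diag(ε, 1)` normalise `ZN`: moving `matU` to the right past `matZ η * matN b` only
rescales `b` by a unit. So an element of `Γ_∞` merely permutes the summands. -/
theorem isInvariant_unitSum {k : Fin d → ℕ} {φ : (Fin d → ℂ) → ℂ}
    (hφ : ∀ η : (𝓞 F)ˣ, ∀ b ∈ (𝔠 * different F)⁻¹,
      EqOn (slash σ k (matZ η * matN b) φ) φ (upperHalf d)) :
    IsInvariant σ k (GammaInf 𝔠) (unitSum σ k φ) := by
  rintro _ ⟨ε, hε, η, b, hb, rfl⟩ z hz
  have hγ : PosDet σ (matU ε * matZ η * matN b) :=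
    posDet_of_mem (gammaInf_le (𝔠 := 𝔠) (𝔫 := ⊤) (matU_mul_matZ_mul_matN_mem hε η hb))
  have hU : ∀ ε : totPosUnits F, PosDet σ (matU (ε : (𝓞 F)ˣ)) := fun ε =>
    posDet_of_mem (matU_mem (𝔠 := 𝔠) (𝔫 := ⊤) ε.2)
  have key : ∀ ε' : totPosUnits F,
      slash σ k (matU ε * matZ η * matN b) (slash σ k (matU (ε' : (𝓞 F)ˣ)) φ) z =
      slash σ k (matU ((ε' * ⟨ε, hε⟩ : totPosUnits F) : (𝓞 F)ˣ)) φ z := by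
    intro ε'
    have hb' := unit_smul_mem _ (((ε' * ⟨ε, hε⟩ : totPosUnits F) : (𝓞 F)ˣ) : 𝓞 F) hb
    have e : matU (ε' : (𝓞 F)ˣ) * (matU ε * matZ η * matN b) =
        matZ η * matN (((((ε' * ⟨ε, hε⟩ : totPosUnits F) : (𝓞 F)ˣ) : 𝓞 F) : F) * b) *
          matU ((ε' * ⟨ε, hε⟩ : totPosUnits F) : (𝓞 F)ˣ) := by
      apply Units.ext
      rw [Units.val_mul, Units.val_mul _ (matU _), matUZN_val, matZ_mul_matN_val, matU_val,
        matU_val]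
      ext i j
      fin_cases i <;> fin_cases j <;> simp [Matrix.mul_apply, Fin.sum_univ_two]
      · ring
      · ring
    rw [slash_slash (hU ε') hγ k φ hz, e,
      ← slash_slash (posDet_of_mem (gammaInf_le (𝔫 := ⊤) (matZ_mul_matN_mem_gammaInf η hb')))
        (hU _) k φ hz]
    exact slash_congr (hφ η _ hb') (hU _) k hz
  unfold unitSum
  rw [slash_tsum]
  simp only [key]
  exact (Equiv.mulRight (⟨ε, hε⟩ : totPosUnits F)).tsum_eq
    fun ε' => slash σ k (matU (ε' : (𝓞 F)ˣ)) φ z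

/-- The representative `diag(ε, 1) M` attached to `ε` and the coset `Γ_∞ M`. -/
noncomputable def cosetRep (p : Cosets 𝔠 𝔫 × totPosUnits F) : GL (Fin 2) F :=
  matU (p.2 : (𝓞 F)ˣ) * (p.1.out : GL (Fin 2) F)

theorem cosetRep_mem (p : Cosets 𝔠 𝔫 × totPosUnits F) : cosetRep p ∈ Gamma0 𝔠 𝔫 :=
  mul_mem (matU_mem p.2.2) p.1.out.2

theorem matU_injective {ε ε' η : (𝓞 F)ˣ} {b : F} (h : matU ε = matZ η * matN b * matU ε') :
    ε = ε' := by
  have h' := congrArg Units.val h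
  rw [Units.val_mul, matZ_mul_matN_val, matU_val, matU_val] at h'
  have h1 := congrFun (congrFun h' 1) 1
  have h0 := congrFun (congrFun h' 0) 0
  simp [Matrix.mul_apply, Fin.sum_univ_two] at h0 h1
  rw [← h1, one_mul] at h0
  exact Units.ext (by simpa using h0)

/-- This is the repetition-free hypothesis of `locSummable_slash_expTr` for the unfolded sum: a
relation modulo `ZN` forces equal `Γ_∞`-cosets, and then `matU_injective` recovers the unit. -/
theorem cosetRep_injective (p p' : Cosets 𝔠 𝔫 × totPosUnits F) (η : (𝓞 F)ˣ) {b : F}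
    (hb : b ∈ (𝔠 * different F)⁻¹) (h : cosetRep p = matZ η * matN b * cosetRep p') :
    p = p' := by
  obtain ⟨q, ε⟩ := p
  obtain ⟨q', ε'⟩ := p'
  simp only [cosetRep] at h
  have hq : q = q' := by
    rw [← Quotient.out_eq q, ← Quotient.out_eq q']
    refine Quotient.sound ?_
    change QuotientGroup.rightRel _ _ _
    rw [QuotientGroup.rightRel_apply, Subgroup.mem_subgroupOf]
    have : ((q'.out * q.out⁻¹ : Gamma0 𝔠 𝔫) : GL (Fin 2) F) =
        (matU (ε' : (𝓞 F)ˣ))⁻¹ * (matZ η * matN b)⁻¹ * matU (ε : (𝓞 F)ˣ) := by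
      rw [Subgroup.coe_mul, Subgroup.coe_inv, mul_inv_eq_iff_eq_mul, mul_assoc _ (matU _), h]
      group
    rw [this]
    exact mul_mem (mul_mem (inv_mem (matU_mem_gammaInf ε'.2))
      (inv_mem (matZ_mul_matN_mem_gammaInf η hb))) (matU_mem_gammaInf ε.2)
  subst hq
  rw [← mul_assoc] at h
  rw [Subtype.ext (matU_injective (mul_right_cancel h))]

theorem poincareTerm_unitSum (k : Fin d → ℕ) (φ : (Fin d → ℂ) → ℂ) (q : Cosets 𝔠 𝔫)
    {z : Fin d → ℂ} (hz : z ∈ upperHalf d) :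
    poincareTerm σ k 𝔠 𝔫 (unitSum σ k φ) q z =
      ∑' ε : totPosUnits F, slash σ k (cosetRep (q, ε)) φ z := by
  unfold poincareTerm unitSum
  rw [slash_tsum]
  exact tsum_congr fun ε => slash_slash (posDet_of_mem (matU_mem (𝔠 := 𝔠) (𝔫 := 𝔫) ε.2))
    (posDet_of_mem q.out.2) k φ hz

theorem poincareSeries_unitSum {k : Fin d → ℕ} {φ : (Fin d → ℂ) → ℂ}
    (hφ : LocSummable fun p : Cosets 𝔠 𝔫 × totPosUnits F => slash σ k (cosetRep p) φ) :
    EqOn (poincareSeries σ k 𝔠 𝔫 (unitSum σ k φ))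
      (fun z => ∑' p : Cosets 𝔠 𝔫 × totPosUnits F, slash σ k (cosetRep p) φ z)
      (upperHalf d) := by
  intro z hz
  have hs : Summable fun p : Cosets 𝔠 𝔫 × totPosUnits F => slash σ k (cosetRep p) φ z :=
    (hφ.summable_norm hz).of_norm
  simp only [poincareSeries, poincareTerm_unitSum k φ _ hz]
  exact (hs.tsum_prod).symm

/-- Summing the majorant of the double family over the units gives a majorant for the coset series;
the Weierstrass test does the rest. -/
theorem poincareWellDefined_unitSum {k : Fin d → ℕ} {φ : (Fin d → ℂ) → ℂ}
    (hφ : LocSummable fun p : Cosets 𝔠 𝔫 × totPosUnits F => slash σ k (cosetRep p) φ)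
    (hinv : ∀ η : (𝓞 F)ˣ, ∀ b ∈ (𝔠 * different F)⁻¹,
      EqOn (slash σ k (matZ η * matN b) φ) φ (upperHalf d)) :
    PoincareWellDefined σ k 𝔠 𝔫 (unitSum σ k φ) := by
  have hloc : LocSummable (poincareTerm σ k 𝔠 𝔫 (unitSum σ k φ)) := by
    intro z hz
    obtain ⟨u, hu, h⟩ := hφ z hz
    refine ⟨fun q => ∑' ε, u (q, ε), hu.prod, ?_⟩
    filter_upwards [h, isOpen_upperHalf.eventually_mem hz] with w hw hwH q
    rw [poincareTerm_unitSum k φ q hwH]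
    exact tsum_of_norm_bounded (hu.prod_factor q).hasSum fun ε => hw (q, ε)
  refine ⟨isInvariant_unitSum hinv, fun z hz => hloc.summable_norm hz, ?_⟩
  intro V hV z hz
  obtain ⟨u, hu, h⟩ := hloc z hz
  refine ⟨_, nhdsWithin_le_nhds h, ?_⟩
  exact tendstoUniformlyOn_tsum hu (s := {w | ∀ q, ‖poincareTerm σ k 𝔠 𝔫 (unitSum σ k φ) q w‖ ≤ u q})
    (fun q w hw => hw q) V hV

theorem rankinCohen_congr (k₁ k₂ n : Fin d → ℕ) {f f' g g' : (Fin d → ℂ) → ℂ}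
    (hf : EqOn f f' (upperHalf d)) (hg : EqOn g g' (upperHalf d)) :
    EqOn (rankinCohen k₁ k₂ n f g) (rankinCohen k₁ k₂ n f' g') (upperHalf d) := by
  intro z hz
  refine Finset.sum_congr rfl fun l _ => ?_
  rw [mixedDeriv_congr hf l hz, mixedDeriv_congr hg (n - l) hz]

theorem LocSummable.rankinCohen {ι : Type*} {g : ι → (Fin d → ℂ) → ℂ} (hg : LocSummable g)
    (hgS : ∀ i, SepHol (g i)) (k₁ k₂ n : Fin d → ℕ) {f : (Fin d → ℂ) → ℂ} (hf : SepHol f) :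
    LocSummable (fun i => HilbertPoincare.rankinCohen k₁ k₂ n f (g i)) ∧
    EqOn (HilbertPoincare.rankinCohen k₁ k₂ n f fun z => ∑' i, g i z)
      (fun z => ∑' i, HilbertPoincare.rankinCohen k₁ k₂ n f (g i) z) (upperHalf d) := by
  refine ⟨fun z hz => ?_, fun z hz => ?_⟩
  · choose C hC using fun l => (hf.mixedDeriv l).bdd z hz
    choose u hu hub using fun l => (hg.mixedDeriv hgS (n - l)).1 z hz
    refine ⟨fun i => ∑ l ∈ Finset.Icc 0 n, ‖bracketCoeff k₁ k₂ n l‖ * C l * u l i,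
      summable_sum fun l _ => (hu l).mul_left _, ?_⟩
    have h1 := (Filter.eventually_all_finset (Finset.Icc 0 n)).2 fun l _ => hC l
    have h2 := (Filter.eventually_all_finset (Finset.Icc 0 n)).2 fun l _ => hub l
    filter_upwards [h1, h2] with w hw1 hw2 i
    refine (norm_sum_le _ _).trans (Finset.sum_le_sum fun l hl => ?_)
    rw [norm_mul, norm_mul]
    have h3 := hw1 l hl
    have h4 := hw2 l hl i
    have h5 := (norm_nonneg _).trans h3
    gcongr
  · simp only [HilbertPoincare.rankinCohen]
    rw [Summable.tsum_finsetSum fun l _ =>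
      (((hg.mixedDeriv hgS (n - l)).1.summable_norm hz).of_norm.mul_left _)]
    refine Finset.sum_congr rfl fun l _ => ?_
    rw [tsum_mul_left, (hg.mixedDeriv hgS (n - l)).2 hz]

end Poincare

end HilbertPoincare

theorem mainTheorem2 {F : Type*} [Field F] [NumberField F] [NumberField.IsTotallyReal F]
    {d : ℕ} (hd : 1 < d) (σ : Fin d ≃ (F →+* ℝ))
    (𝔠 : FractionalIdeal (𝓞 F)⁰ F) (h𝔠 : 𝔠 ≠ 0) (𝔫 : Ideal (𝓞 F)) (h𝔫 : 𝔫 ≠ ⊥)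
    (n k₁ k₂ : Fin d → ℕ) (hk₁ : ∀ i, 2 < k₁ i) (hk₂ : ∀ i, 2 < k₂ i)
    (hsign : ∀ η : (𝓞 F)ˣ, ∏ i, Real.sign (σ i ((η : 𝓞 F) : F)) ^ k₂ i = 1)
    (μ : F) (hμ𝔠 : μ ∈ 𝔠) (hμ : HilbertPoincare.IsTotallyPositive μ)
    (f : (Fin d → ℂ) → ℂ) (hf : HilbertPoincare.IsModularForm σ k₁ 𝔠 𝔫 f)
    (hcusp : ¬ HilbertPoincare.IsCuspForm σ k₁ 𝔠 𝔫 f → ∀ i, k₁ i + 2 ≤ k₂ i) :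
    -- the sums over the totally positive units that form the two seeds converge absolutely
    (∀ z ∈ HilbertPoincare.upperHalf d,
      Summable (fun ε : HilbertPoincare.totPosUnits F =>
        ‖(HilbertPoincare.halfPow σ (((ε : (𝓞 F)ˣ) : 𝓞 F) : F) k₂ : ℂ) *
          HilbertPoincare.expTr σ ((((ε : (𝓞 F)ˣ) : 𝓞 F) : F) * μ) z‖) ∧
      Summable (fun ε : HilbertPoincare.totPosUnits F =>
        ‖HilbertPoincare.slash σ (k₁ + k₂ + 2 • n) (HilbertPoincare.matU (ε : (𝓞 F)ˣ))
          (HilbertPoincare.bracketSeed σ k₁ k₂ n μ f) z‖)) ∧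
    -- both Poincaré series are well defined
    HilbertPoincare.PoincareWellDefined σ k₂ 𝔠 𝔫 (HilbertPoincare.seedP σ k₂ μ) ∧
    HilbertPoincare.PoincareWellDefined σ (k₁ + k₂ + 2 • n) 𝔠 𝔫
      (HilbertPoincare.unitSum σ (k₁ + k₂ + 2 • n)
        (HilbertPoincare.bracketSeed σ k₁ k₂ n μ f)) ∧
    -- the bracket is the Poincaré series of the given seed
    ∀ z ∈ HilbertPoincare.upperHalf d,
      HilbertPoincare.rankinCohen k₁ k₂ n f (HilbertPoincare.poincareP σ k₂ 𝔠 𝔫 μ) z =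
        HilbertPoincare.poincareSeries σ (k₁ + k₂ + 2 • n) 𝔠 𝔫
          (HilbertPoincare.unitSum σ (k₁ + k₂ + 2 • n)
            (HilbertPoincare.bracketSeed σ k₁ k₂ n μ f)) z := by
  open HilbertPoincare Set in
  have hk₁' : ∀ i, 0 < k₁ i := fun i => (Nat.zero_le _).trans_lt (hk₁ i)
  have hk₂' : ∀ i, 0 < k₂ i := fun i => (Nat.zero_le _).trans_lt (hk₂ i)
  have hfS : SepHol f := .of_differentiableOn hf.1
  have heD : DifferentiableOn ℂ (expTr σ μ) (upperHalf d) :=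
    (differentiable_expTr μ).differentiableOn
  have hslashD : ∀ γ ∈ Gamma0 𝔠 𝔫, SepHol (slash σ k₂ γ (expTr σ μ)) := fun γ hγ =>
    .of_differentiableOn (differentiableOn_slash heD (posDet_of_mem hγ) k₂)
  -- The termwise form of the theorem: equivariance of the bracket combined with `f|γ = f`.
  have hbr : ∀ γ ∈ Gamma0 𝔠 𝔫,
      EqOn (slash σ (k₁ + k₂ + 2 • n) γ (bracketSeed σ k₁ k₂ n μ f))
        (rankinCohen k₁ k₂ n f (slash σ k₂ γ (expTr σ μ))) (upperHalf d) := by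
    intro γ hγ z hz
    rw [bracketSeed_eq, ← rankinCohen_slash (posDet_of_mem hγ) hk₁' hk₂' n hf.1 heD hz]
    exact rankinCohen_congr k₁ k₂ n (hf.2 γ hγ) (fun _ _ => rfl) hz
  -- The majorant for the bracket terms is derived from that of the exponential terms through `hbr`.
  -- It is used for the units alone (`hU`) and for pairs of a coset and a unit (`hP`).
  have hloc : ∀ {ι : Type _} {m : ι → GL (Fin 2) F}, (∀ i, m i ∈ Gamma0 𝔠 𝔫) →
      (∀ i j (η : (𝓞 F)ˣ), ∀ b ∈ (𝔠 * different F)⁻¹, m i = matZ η * matN b * m j → i = j) →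
      LocSummable (fun i => slash σ k₂ (m i) (expTr σ μ)) ∧
      LocSummable (fun i => slash σ (k₁ + k₂ + 2 • n) (m i) (bracketSeed σ k₁ k₂ n μ f)) := by
    intro ι m hm hinj
    have h1 := locSummable_slash_expTr (σ := σ) hm hinj hk₂ hμ
    refine ⟨h1, fun z hz => ?_⟩
    obtain ⟨u, hu, h2⟩ := (h1.rankinCohen (fun i => hslashD _ (hm i)) k₁ k₂ n hfS).1 z hz
    refine ⟨u, hu, ?_⟩
    filter_upwards [h2, isOpen_upperHalf.eventually_mem hz] with w hw hwH i
    rw [hbr _ (hm i) hwH]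
    exact hw i
  have hU := hloc (m := fun ε : totPosUnits F => matU (ε : (𝓞 F)ˣ)) (fun ε => matU_mem ε.2)
    fun ε ε' η b _ h => Subtype.ext (matU_injective h)
  have hP := hloc (m := cosetRep (𝔠 := 𝔠) (𝔫 := 𝔫)) cosetRep_mem
    fun p p' η b hb h => cosetRep_injective p p' η hb h
  have hinve : ∀ η : (𝓞 F)ˣ, ∀ b ∈ (𝔠 * different F)⁻¹,
      EqOn (slash σ k₂ (matZ η * matN b) (expTr σ μ)) (expTr σ μ) (upperHalf d) :=
    fun η b hb z _ => slash_matZ_mul_matN_expTr h𝔠 hμ𝔠 hb (hsign η) z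
  -- Invariance of `φ` under `ZN` reduces through `hbr` to that of the exponential.
  have hinvb : ∀ η : (𝓞 F)ˣ, ∀ b ∈ (𝔠 * different F)⁻¹,
      EqOn (slash σ (k₁ + k₂ + 2 • n) (matZ η * matN b) (bracketSeed σ k₁ k₂ n μ f))
        (bracketSeed σ k₁ k₂ n μ f) (upperHalf d) := by
    intro η b hb z hz
    rw [hbr _ (gammaInf_le (matZ_mul_matN_mem_gammaInf η hb)) hz, bracketSeed_eq]
    exact rankinCohen_congr k₁ k₂ n (fun _ _ => rfl) (hinve η b hb) hz
  obtain ⟨hseed, hseedε⟩ := seedP_eq (σ := σ) k₂ μ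
  refine ⟨fun z hz => ⟨?_, hU.2.summable_norm hz⟩, ?_, poincareWellDefined_unitSum hP.2 hinvb,
    fun z hz => ?_⟩
  · simpa only [hseedε] using hU.1.summable_norm hz
  · rw [hseed]
    exact poincareWellDefined_unitSum hP.1 hinve
  · have h1 : EqOn (poincareP σ k₂ 𝔠 𝔫 μ)
        (fun z => ∑' p : Cosets 𝔠 𝔫 × totPosUnits F, slash σ k₂ (cosetRep p) (expTr σ μ) z)
        (upperHalf d) := by
      rw [poincareP, hseed]
      exact poincareSeries_unitSum hP.1
    rw [rankinCohen_congr k₁ k₂ n (fun _ _ => rfl) h1 hz,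
      (hP.1.rankinCohen (fun p => hslashD _ (cosetRep_mem p)) k₁ k₂ n hfS).2 hz,
      poincareSeries_unitSum hP.2 hz]
    exact tsum_congr fun p => (hbr _ (cosetRep_mem p) hz).symm
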